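/- Let $N\ge 0$, let $G=(V,E)$ be the $(N+2)\times(N+2)$ grid graph on $V=\{0,\dots,N+1\}^2$ (edges join horizontally or vertically adjacent sites), let $B=\{1,\dots,N\}^2$ be its interior and $\partial B=V\setminus B$ (corners included). Let $x_{\partial B}\in\{-1,1\}^{\partial B}$ be a one-run boundary configuration: $R^+=\{i\in\partial B: x_i=1\}$ is nonempty and connected, and $R^-=\{i\in\partial B: x_i=-1\}$ is nonempty. For $x_B\in\{-1,1\}^B$ let $O(x_B,x_{\partial B})$ be the number of edges with at least one endpoint in $B$ whose two endpoints carry different values, and for $i\in B$ put $$O_i^*(\pm1)=\min_{x_B:\,x_i=\pm1}O(x_B,x_{\partial B}),\qquad o_i^*=O_i^*(-1)-O_i^*(1)\quad\text{(the local solution at } i).$$ For a sign $\pm$, a $\pm$-simple path is the set $P$ of sites of a path in $G$ that joins the two endpoints of $R^\pm$ (which coincide if $R^\pm$ has only one site), has all its sites in $B\cup R^\pm$, and has the smallest possible number of sites among such paths. For such $P$ let $\overline{P}$ be the set of all sites of $V$ that lie on $P\cup R^\pm$ or are enclosed by it in the plane. Let the inner path $P_I^\pm$ (resp. the outer path $P_O^\pm$)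 be the $\pm$-simple path $P$ for which $|\overline{P}|$ is minimal (resp. maximal). Put $I^\pm=\overline{P_I^\pm}$, $O^\pm=\overline{P_O^\pm}$, $\mathcal I^\pm=I^\pm\cap B$, $\mathcal O^\pm=O^\pm\cap B$, and $$\delta\mathcal I^\pm=\{v\in\mathcal I^\pm : v \text{ has a neighbor in } O^\mp\}.$$ Then each of the four paths $P_I^\pm,P_O^\pm$ exists and is unique, and every $i\in B$ falls in one of the cases on the right of $$o_i^*=\begin{cases}\pm4 & \text{if } i\in\mathcal I^\pm\setminus\delta\mathcal I^\pm,\\ \pm2 & \text{if } i\in\delta\mathcal I^\pm,\\ 0 & \text{if } i\in\mathcal O^+\cap\mathcal O^-,\end{cases}$$ and its local solution has the stated value. -/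

import Mathlib

/-! Local solutions of the boundary interpolation problem on a square grid. -/

namespace GridInterp

/-- The sites of the `(N+2) × (N+2)` grid, with coordinates `0, …, N+1`. -/
abbrev Site (N : ℕ) : Type := Fin (N + 2) × Fin (N + 2)

/-- The `(N+2) × (N+2)` grid graph with the 4-neighbour topology. -/
abbrev grid (N : ℕ) : SimpleGraph (Site N) :=
  SimpleGraph.boxProd (SimpleGraph.pathGraph (N + 2)) (SimpleGraph.pathGraph (N + 2))

/-- The interior `B`: the sites with both coordinates in `1, …, N`, that is, the sites that have
four neighbours. -/
def interior (N : ℕ) : Set (Site N) :=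
  {v | 1 ≤ (v.1 : ℕ) ∧ (v.1 : ℕ) ≤ N ∧ 1 ≤ (v.2 : ℕ) ∧ (v.2 : ℕ) ≤ N}

/-- The boundary `∂B = V \ B` (the four corners of the grid included). -/
def boundary (N : ℕ) : Set (Site N) := (interior N)ᶜ

/-- Boundary configurations; the values `-1, 1` are the elements of `ℤˣ`. -/
abbrev BoundaryConfig (N : ℕ) : Type := boundary N → ℤˣ

/-- Interior configurations. -/
abbrev InteriorConfig (N : ℕ) : Type := interior N → ℤˣ

open Classical in
/-- The configuration on all sites given by a boundary and an interior configuration. -/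
noncomputable def glue {N : ℕ} (x : BoundaryConfig N) (y : InteriorConfig N) : Site N → ℤˣ :=
  fun v => if h : v ∈ interior N then y ⟨v, h⟩ else x ⟨v, h⟩

/-- The number `O(x_B, x_∂B)` of odd bonds: edges with at least one endpoint in `B` whose
endpoints carry different values. -/
noncomputable def oddBonds {N : ℕ} (x : BoundaryConfig N) (y : InteriorConfig N) : ℕ :=
  {e : Sym2 (Site N) | e ∈ (grid N).edgeSet ∧ (∃ i ∈ e, i ∈ interior N) ∧
    ∃ i ∈ e, ∃ j ∈ e, glue x y i ≠ glue x y j}.ncard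

/-- `O*_i(s)`: the minimum of the number of odd bonds over the interior configurations with value
`s` at the site `i` (the set of values is never empty). -/
noncomputable def minOddBonds {N : ℕ} (x : BoundaryConfig N) (i : interior N) (s : ℤˣ) : ℕ :=
  sInf (oddBonds x '' {y : InteriorConfig N | y i = s})

/-- The local solution `o*_i = O*_i(-1) - O*_i(1)`. -/
noncomputable def localSolution {N : ℕ} (x : BoundaryConfig N) (i : interior N) : ℤ :=
  (minOddBonds x i (-1) : ℤ) - (minOddBonds x i 1 : ℤ)

/-- The set `R^s` of boundary sites with value `s`. -/
def run {N : ℕ} (x : BoundaryConfig N) (s : ℤˣ) : Set (Site N) :=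
  {v | ∃ h : v ∈ boundary N, x ⟨v, h⟩ = s}

/-- One-run boundary configurations: `R^+` is connected (in particular nonempty), and both values
occur, so that there are a positive and a negative run. -/
def IsOneRun {N : ℕ} (x : BoundaryConfig N) : Prop :=
  ((grid N).induce (run x 1)).Connected ∧ (run x (-1)).Nonempty

/-- The endpoints of the run `R^s`: its sites with at most one neighbour in `R^s`. A run with a
single site has this site as its only endpoint. -/
def runEnds {N : ℕ} (x : BoundaryConfig N) (s : ℤˣ) : Set (Site N) :=
  {v | v ∈ run x s ∧ ((grid N).neighborSet v ∩ run x s).ncard ≤ 1}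

/-- Paths that join the two endpoints of `R^s` and all of whose sites lie in `B` or in `R^s`. -/
def JoinsEnds {N : ℕ} (x : BoundaryConfig N) (s : ℤˣ) {u v : Site N} (w : (grid N).Walk u v) :
    Prop :=
  w.IsPath ∧ runEnds x s = {u, v} ∧ ∀ z ∈ w.support, z ∈ interior N ∨ z ∈ run x s

/-- The `s`-simple paths, as sets of sites: the sets of sites of the shortest paths as above. -/
def IsSimplePath {N : ℕ} (x : BoundaryConfig N) (s : ℤˣ) (P : Set (Site N)) : Prop :=
  ∃ (u v : Site N) (w : (grid N).Walk u v), JoinsEnds x s w ∧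
    (∀ (u' v' : Site N) (w' : (grid N).Walk u' v'), JoinsEnds x s w' → w.length ≤ w'.length) ∧
    P = {z | z ∈ w.support}

/-- Two sites differ by at most one in each coordinate (they are equal, or neighbours
horizontally, vertically or diagonally). -/
def Near {N : ℕ} (v w : Site N) : Prop :=
  (v.1 : ℕ) ≤ w.1 + 1 ∧ (w.1 : ℕ) ≤ v.1 + 1 ∧ (v.2 : ℕ) ≤ w.2 + 1 ∧ (w.2 : ℕ) ≤ v.2 + 1

/-- The site `v` is enclosed by the set of sites `S`, drawn in the plane together with the unit
segments between horizontally or vertically adjacent sites of `S`: `v` is not in `S`, and it lies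
in a bounded component of the complement of the drawing. Since the drawing consists of horizontal
and vertical unit segments, a curve can avoid it exactly along horizontal, vertical or diagonal
steps through sites outside `S`; and the sites of `∂B` outside `S` border the exterior of the
grid. -/
def Encloses {N : ℕ} (S : Set (Site N)) (v : Site N) : Prop :=
  v ∉ S ∧ ¬ ∃ u, u ∈ boundary N ∧ u ∉ S ∧
    Relation.ReflTransGen (fun a b : Site N => Near a b ∧ b ∉ S) v u

/-- `P ∪ R^s` together with the sites enclosed by it. -/
def closedRegion {N : ℕ} (x : BoundaryConfig N) (s : ℤˣ) (P : Set (Site N)) : Set (Site N) :=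
  {v | v ∈ P ∪ run x s ∨ Encloses (P ∪ run x s) v}

/-- `P` is an inner path of sign `s`: a simple path for which the number of sites on or inside
`P ∪ R^s` is minimal. -/
def IsInnerPath {N : ℕ} (x : BoundaryConfig N) (s : ℤˣ) (P : Set (Site N)) : Prop :=
  IsSimplePath x s P ∧
    ∀ Q, IsSimplePath x s Q → (closedRegion x s P).ncard ≤ (closedRegion x s Q).ncard

/-- `P` is an outer path of sign `s`: a simple path for which the number of sites on or inside
`P ∪ R^s` is maximal. -/
def IsOuterPath {N : ℕ} (x : BoundaryConfig N) (s : ℤˣ) (P : Set (Site N)) : Prop :=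
  IsSimplePath x s P ∧
    ∀ Q, IsSimplePath x s Q → (closedRegion x s Q).ncard ≤ (closedRegion x s P).ncard

/-- `I^s`: the closed region of the inner path of sign `s`. -/
def innerSet {N : ℕ} (x : BoundaryConfig N) (s : ℤˣ) : Set (Site N) :=
  {v | ∃ P, IsInnerPath x s P ∧ v ∈ closedRegion x s P}

/-- `O^s`: the closed region of the outer path of sign `s`. -/
def outerSet {N : ℕ} (x : BoundaryConfig N) (s : ℤˣ) : Set (Site N) :=
  {v | ∃ P, IsOuterPath x s P ∧ v ∈ closedRegion x s P}

/-- The inner region `𝓘^s = I^s ∩ B`. -/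
def innerRegion {N : ℕ} (x : BoundaryConfig N) (s : ℤˣ) : Set (Site N) :=
  innerSet x s ∩ interior N

/-- The outer region `𝓞^s = O^s ∩ B`. -/
def outerRegion {N : ℕ} (x : BoundaryConfig N) (s : ℤˣ) : Set (Site N) :=
  outerSet x s ∩ interior N

/-- `δ𝓘^s`: the sites of `𝓘^s` that touch (have a neighbour in) `O^{-s}`. -/
def innerRim {N : ℕ} (x : BoundaryConfig N) (s : ℤˣ) : Set (Site N) :=
  {v | v ∈ innerRegion x s ∧ ∃ w ∈ outerSet x (-s), (grid N).Adj v w}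

end GridInterp

/-! Call an interior row or column, together with its two boundary ends, a line. The edges that meet
`B` are exactly the edges of the lines, so the number of odd bonds is the total number of sign
changes along lines (`oddBonds_eq_totalChanges`). A line has at least one sign change if its ends
differ, and each lower bound depends on the boundary only.

The `core` of sign `s` consists of `R^s` and the interior sites that lie on a line with both ends in
`R^s`. For a one-run boundary, sites of opposite signs never alternate around the boundary cycle
(`run_between`). Hence the core contains all or nothing of a line with equal ends, and it switches
only once on a line with different ends (`core_row`). So giving the core the value `s` and
everything else the value `-s` attains the lower bound on all lines at once: `coreConfig x 1` and
`coreConfig x (-1)` are both global minimizers.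

Now let `i` be an interior site. If `i` is in neither core, the two minimizers have opposite values
at `i` and the local solution is `0`. If `i` is in the core of sign `s`, the value `-s` at `i`
spoils a line with both ends equal to `s` and costs at least 2 (`oddBonds_coreConfig_add_two_le`).
If moreover all four neighbours are in the core, a second line is spoiled as well and the cost is at
least 4 (`IsTightFor.total_add_four_le`). Flipping the single site `i` in the core configuration
attains both bounds (`exists_oddBonds_le`).

It remains to identify the regions with cores: `I^s` is the core of sign `s`, and `O^s` is the
complement of the core of sign `-s` (`pathsBoundCores_of_isOneRun`). The closed region of every
simple path lies between these two sets and determines the path, and both bounds are attained; this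
yields existence and uniqueness together (`pathsBoundCores_of`). Up to reflections of the grid there
are two situations. If two opposite corners have different signs, the run can be reflected into a
position where the simple paths are the monotone lattice paths between its ends within the allowed
sites, and the closed region is everything to the lower left of the path (`IsStaircaseRun`). If all
corners have the same sign, the other sign occupies an interval inside one side; this run is its own
simple path, and the complementary run has exactly one simple path, the detour around the interval
(`IsTopRun`). -/

namespace GridInterp

variable {N : ℕ}

/-! ### Coordinates -/

theorem Site.ext_nat {v w : Site N} (h₁ : (v.1 : ℕ) = w.1) (h₂ : (v.2 : ℕ) = w.2) : v = w :=
  Prod.ext (Fin.ext h₁) (Fin.ext h₂)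

theorem Site.fst_le (v : Site N) : (v.1 : ℕ) ≤ N + 1 := by
  have := v.1.isLt; omega

theorem Site.snd_le (v : Site N) : (v.2 : ℕ) ≤ N + 1 := by
  have := v.2.isLt; omega

theorem grid_adj_iff {v w : Site N} : (grid N).Adj v w ↔
    (((v.1 : ℕ) + 1 = w.1 ∨ (w.1 : ℕ) + 1 = v.1) ∧ (v.2 : ℕ) = w.2) ∨
      (((v.2 : ℕ) + 1 = w.2 ∨ (w.2 : ℕ) + 1 = v.2) ∧ (v.1 : ℕ) = w.1) := by
  simp only [SimpleGraph.boxProd_adj, SimpleGraph.pathGraph_adj, Fin.ext_iff]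

/-- The site with given coordinates. -/
def site (N i j : ℕ) : Site N := (Fin.ofNat (N + 2) i, Fin.ofNat (N + 2) j)

theorem site_fst {i j : ℕ} (h : i ≤ N + 1) : ((site N i j).1 : ℕ) = i :=
  Nat.mod_eq_of_lt (by omega)

theorem site_snd {i j : ℕ} (h : j ≤ N + 1) : ((site N i j).2 : ℕ) = j :=
  Nat.mod_eq_of_lt (by omega)

theorem site_coords (v : Site N) : site N v.1 v.2 = v :=
  Site.ext_nat (site_fst v.fst_le) (site_snd v.snd_le)

theorem eq_site {v : Site N} {i j : ℕ} (h₁ : (v.1 : ℕ) = i) (h₂ : (v.2 : ℕ) = j) :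
    v = site N i j := by
  subst h₁ h₂; exact (site_coords v).symm

theorem mem_boundary_iff {v : Site N} : v ∈ boundary N ↔
    (v.1 : ℕ) = 0 ∨ (v.1 : ℕ) = N + 1 ∨ (v.2 : ℕ) = 0 ∨ (v.2 : ℕ) = N + 1 := by
  have h₁ := v.fst_le
  have h₂ := v.snd_le
  simp only [boundary, interior, Set.mem_compl_iff, Set.mem_ofPred_eq]
  omega

theorem mem_interior_iff {v : Site N} : v ∈ interior N ↔
    1 ≤ (v.1 : ℕ) ∧ (v.1 : ℕ) ≤ N ∧ 1 ≤ (v.2 : ℕ) ∧ (v.2 : ℕ) ≤ N := Iff.rfl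

/-! ### Runs -/

theorem units_eq_or (s t : ℤˣ) : t = s ∨ t = -s := by
  rcases Int.units_eq_one_or s with rfl | rfl <;> rcases Int.units_eq_one_or t with rfl | rfl <;>
    simp

theorem units_ne_neg (s : ℤˣ) : s ≠ -s := by
  rcases Int.units_eq_one_or s with rfl | rfl <;> decide

theorem run_subset_boundary {x : BoundaryConfig N} {s : ℤˣ} {v : Site N} (h : v ∈ run x s) :
    v ∈ boundary N := h.1

theorem mem_run_neg_iff {x : BoundaryConfig N} {s : ℤˣ} {v : Site N} :
    v ∈ run x (-s) ↔ v ∈ boundary N ∧ v ∉ run x s := by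
  constructor
  · rintro ⟨h, hs⟩
    exact ⟨h, fun ⟨_, h'⟩ => units_ne_neg s (h'.symm.trans hs)⟩
  · rintro ⟨h, hs⟩
    refine ⟨h, (units_eq_or s _).resolve_left fun h' => hs ⟨h, h'⟩⟩

theorem mem_run_or {x : BoundaryConfig N} (s : ℤˣ) {v : Site N} (h : v ∈ boundary N) :
    v ∈ run x s ∨ v ∈ run x (-s) := by
  by_cases h' : v ∈ run x s
  · exact Or.inl h'
  · exact Or.inr (mem_run_neg_iff.2 ⟨h, h'⟩)

/-- The sites of `R^s` together with the interior sites whose row or column has both of its ends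
in `R^s`. -/
def core (x : BoundaryConfig N) (s : ℤˣ) : Set (Site N) :=
  {v | v ∈ run x s ∨ v ∈ interior N ∧
    ((site N v.1 0 ∈ run x s ∧ site N v.1 (N + 1) ∈ run x s) ∨
      (site N 0 v.2 ∈ run x s ∧ site N (N + 1) v.2 ∈ run x s))}

/-! ### Walks in the grid -/

/-- The length of a walk is at least the l¹-distance of its ends; the four inequalities are the four
choices of signs for the absolute values, free of subtraction. -/
theorem walk_length_bounds {u v : Site N} (w : (grid N).Walk u v) :
    (v.1 : ℕ) + v.2 ≤ w.length + u.1 + u.2 ∧ (u.1 : ℕ) + u.2 ≤ w.length + v.1 + v.2 ∧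
      (v.1 : ℕ) + u.2 ≤ w.length + u.1 + v.2 ∧ (u.1 : ℕ) + v.2 ≤ w.length + v.1 + u.2 := by
  induction w with
  | nil => simp
  | cons h w ih =>
    rw [grid_adj_iff] at h
    simp only [SimpleGraph.Walk.length_cons]
    omega

/-- A shortest walk from `u` to `v`, with `u ≤ v`, moves only in the two increasing directions. -/
theorem geodesic_support {u v : Site N} (w : (grid N).Walk u v)
    (h₁ : (u.1 : ℕ) ≤ v.1) (h₂ : (u.2 : ℕ) ≤ v.2) (hw : w.length + u.1 + u.2 ≤ v.1 + v.2) :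
    (∀ z ∈ w.support, (u.1 : ℕ) ≤ z.1 ∧ (u.2 : ℕ) ≤ z.2 ∧ (z.1 : ℕ) ≤ v.1 ∧ (z.2 : ℕ) ≤ v.2) ∧
      (∀ z ∈ w.support, ∀ z' ∈ w.support, ((z.1 : ℕ) ≤ z'.1 ∧ (z.2 : ℕ) ≤ z'.2) ∨
        ((z'.1 : ℕ) ≤ z.1 ∧ (z'.2 : ℕ) ≤ z.2)) ∧
      ∀ t : ℕ, (u.1 : ℕ) + u.2 ≤ t → t ≤ v.1 + v.2 →
        ∃ z ∈ w.support, (z.1 : ℕ) + z.2 = t := by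
  induction w with
  | nil =>
    refine ⟨by simp, by simp, fun t ht ht' => ⟨_, by simp; rfl, by omega⟩⟩
  | @cons u u' v h w ih =>
    rw [grid_adj_iff] at h
    simp only [SimpleGraph.Walk.length_cons] at hw
    have hb := walk_length_bounds w
    obtain ⟨ih₁, ih₂, ih₃⟩ := ih (by omega) (by omega) (by omega)
    have key : ∀ z ∈ w.support, (u.1 : ℕ) ≤ z.1 ∧ (u.2 : ℕ) ≤ z.2 ∧ (z.1 : ℕ) ≤ v.1 ∧
        (z.2 : ℕ) ≤ v.2 := fun z hz => by have := ih₁ z hz; omega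
    simp only [SimpleGraph.Walk.support_cons, List.mem_cons]
    refine ⟨?_, ?_, ?_⟩
    · rintro z (rfl | hz)
      · omega
      · exact key z hz
    · rintro z (rfl | hz) z' (rfl | hz')
      · omega
      · have := key z' hz'; omega
      · have := key z hz; omega
      · exact ih₂ z hz z' hz'
    · intro t ht ht'
      by_cases htu : t = u.1 + u.2
      · exact ⟨u, Or.inl rfl, htu.symm⟩
      · obtain ⟨z, hz, hzt⟩ := ih₃ t (by omega) ht'
        exact ⟨z, Or.inr hz, hzt⟩

/-- Downward straight walks. -/
theorem exists_vertical_walk {i i' j : ℕ} (h : i ≤ i') (hi : i' ≤ N + 1) (hj : j ≤ N + 1) :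
    ∃ w : (grid N).Walk (site N i j) (site N i' j), w.length = i' - i ∧
      ∀ z, z ∈ w.support ↔ (z.2 : ℕ) = j ∧ i ≤ z.1 ∧ (z.1 : ℕ) ≤ i' := by
  induction i', h using Nat.le_induction with
  | base =>
    refine ⟨.nil, by simp, fun z => ?_⟩
    simp only [SimpleGraph.Walk.support_nil, List.mem_singleton]
    constructor
    · rintro rfl; rw [site_fst hi, site_snd hj]; omega
    · rintro ⟨h₁, h₂, h₃⟩; exact eq_site (by omega) h₁
  | succ k hk ih =>
    obtain ⟨w, hw, hs⟩ := ih (by omega)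
    have hadj : (grid N).Adj (site N k j) (site N (k + 1) j) := by
      rw [grid_adj_iff, site_fst hi, site_snd hj, site_snd hj, site_fst (by omega)]; omega
    refine ⟨w.concat hadj, by rw [SimpleGraph.Walk.length_concat]; omega, fun z => ?_⟩
    rw [SimpleGraph.Walk.support_concat, List.mem_append, hs, List.mem_singleton]
    constructor
    · rintro (h | rfl)
      · omega
      · rw [site_fst hi, site_snd hj]; omega
    · rintro ⟨h₁, h₂, h₃⟩
      by_cases hz : (z.1 : ℕ) = k + 1
      · exact Or.inr (eq_site hz h₁)
      · exact Or.inl ⟨h₁, h₂, by omega⟩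

/-- Straight walks to the right. -/
theorem exists_horizontal_walk {i j j' : ℕ} (h : j ≤ j') (hi : i ≤ N + 1) (hj : j' ≤ N + 1) :
    ∃ w : (grid N).Walk (site N i j) (site N i j'), w.length = j' - j ∧
      ∀ z, z ∈ w.support ↔ (z.1 : ℕ) = i ∧ j ≤ z.2 ∧ (z.2 : ℕ) ≤ j' := by
  induction j', h using Nat.le_induction with
  | base =>
    refine ⟨.nil, by simp, fun z => ?_⟩
    simp only [SimpleGraph.Walk.support_nil, List.mem_singleton]
    constructor
    · rintro rfl; rw [site_fst hi, site_snd hj]; omega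
    · rintro ⟨h₁, h₂, h₃⟩; exact eq_site h₁ (by omega)
  | succ k hk ih =>
    obtain ⟨w, hw, hs⟩ := ih (by omega)
    have hadj : (grid N).Adj (site N i k) (site N i (k + 1)) := by
      rw [grid_adj_iff, site_fst hi, site_snd hj, site_fst hi, site_snd (by omega)]; omega
    refine ⟨w.concat hadj, by rw [SimpleGraph.Walk.length_concat]; omega, fun z => ?_⟩
    rw [SimpleGraph.Walk.support_concat, List.mem_append, hs, List.mem_singleton]
    constructor
    · rintro (h | rfl)
      · omega
      · rw [site_fst hi, site_snd hj]; omega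
    · rintro ⟨h₁, h₂, h₃⟩
      by_cases hz : (z.2 : ℕ) = k + 1
      · exact Or.inr (eq_site h₁ hz)
      · exact Or.inl ⟨h₁, h₂, by omega⟩

/-! ### Simple paths from one shortest admissible walk -/

/-- Cutting out the loops of a walk does not leave `A`, so a shortest walk within `A` has no loops.
Path conditions can therefore be dropped when comparing lengths. -/
theorem isPath_of_length_minimal {V : Type*} {G : SimpleGraph V} {A : Set V} {u v : V}
    (w : G.Walk u v) (hA : ∀ z ∈ w.support, z ∈ A)
    (hmin : ∀ w' : G.Walk u v, (∀ z ∈ w'.support, z ∈ A) → w.length ≤ w'.length) : w.IsPath := by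
  classical
  have h := w.bypass_eq_self_of_length_le_length_bypass
    (hmin _ fun z hz => hA z (w.support_bypass_subset_support hz))
  rw [← h]
  exact w.bypass_isPath

/-- `JoinsEnds` prescribes the ends only as an unordered pair, so a competitor may run from `v` to
`u`; reversal fixes the orientation. Then one known shortest walk `w₀` determines the length of all
simple paths. -/
theorem isSimplePath_iff {x : BoundaryConfig N} {s : ℤˣ} {u v : Site N}
    (hends : runEnds x s = {u, v}) (w₀ : (grid N).Walk u v)
    (hw₀ : ∀ z ∈ w₀.support, z ∈ interior N ∪ run x s)
    (hmin : ∀ w : (grid N).Walk u v, (∀ z ∈ w.support, z ∈ interior N ∪ run x s) →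
      w₀.length ≤ w.length) (P : Set (Site N)) :
    IsSimplePath x s P ↔ ∃ w : (grid N).Walk u v, w.IsPath ∧
      (∀ z ∈ w.support, z ∈ interior N ∪ run x s) ∧ w.length = w₀.length ∧
      P = {z | z ∈ w.support} := by
  have hp := isPath_of_length_minimal w₀ hw₀ hmin
  have key : ∀ (u' v' : Site N) (w' : (grid N).Walk u' v'), JoinsEnds x s w' →
      ∃ w : (grid N).Walk u v, w.IsPath ∧ (∀ z ∈ w.support, z ∈ interior N ∪ run x s) ∧
        w.length = w'.length ∧ ∀ z, z ∈ w'.support ↔ z ∈ w.support := by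
    rintro u' v' w' ⟨h₁, h₂, h₃⟩
    rw [hends, Set.pair_eq_pair_iff] at h₂
    rcases h₂ with ⟨rfl, rfl⟩ | ⟨rfl, rfl⟩
    · exact ⟨w', h₁, h₃, rfl, fun z => Iff.rfl⟩
    · refine ⟨w'.reverse, h₁.reverse, ?_, by simp, by simp⟩
      intro z hz
      exact h₃ z (by simpa using hz)
  constructor
  · rintro ⟨u', v', w', hJ, hm, rfl⟩
    obtain ⟨w, h₁, h₂, h₃, h₄⟩ := key u' v' w' hJ
    refine ⟨w, h₁, h₂, le_antisymm ?_ (hmin w h₂), by ext z; exact h₄ z⟩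
    rw [h₃]
    exact hm u v w₀ ⟨hp, hends, hw₀⟩
  · rintro ⟨w, h₁, h₂, h₃, rfl⟩
    refine ⟨u, v, w, ⟨h₁, hends, h₂⟩, ?_, rfl⟩
    intro u' v' w' hJ
    obtain ⟨w'', _, h₅, h₆, _⟩ := key u' v' w' hJ
    rw [h₃, ← h₆]
    exact hmin w'' h₅

/-! ### Identification of the inner and outer sets -/

/-- The inner and the outer path of sign `s` exist, are unique, and bound the cores. -/
def PathsBoundCores (x : BoundaryConfig N) (s : ℤˣ) : Prop :=
  (∃! P, IsInnerPath x s P) ∧ (∃! P, IsOuterPath x s P) ∧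
    innerSet x s = core x s ∧ outerSet x s = (core x (-s))ᶜ

/-- A squeeze: all closed regions lie between two fixed sets, and both are attained. A region of
extremal cardinality must then equal the corresponding bound, and since a simple path is determined
by its region, the extremal path is unique. -/
theorem pathsBoundCores_of {x : BoundaryConfig N} {s : ℤˣ}
    (hbd : ∀ P, IsSimplePath x s P →
      core x s ⊆ closedRegion x s P ∧ closedRegion x s P ⊆ (core x (-s))ᶜ)
    (hinj : ∀ P Q, IsSimplePath x s P → IsSimplePath x s Q →
      closedRegion x s P = closedRegion x s Q → P = Q)
    (hin : ∃ P, IsSimplePath x s P ∧ closedRegion x s P ⊆ core x s)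
    (hout : ∃ P, IsSimplePath x s P ∧ (core x (-s))ᶜ ⊆ closedRegion x s P) :
    PathsBoundCores x s := by
  obtain ⟨P, hP, hPc⟩ := hin
  obtain ⟨Q, hQ, hQc⟩ := hout
  have hPe : closedRegion x s P = core x s := hPc.antisymm (hbd P hP).1
  have hQe : closedRegion x s Q = (core x (-s))ᶜ := (hbd Q hQ).2.antisymm hQc
  have hPI : IsInnerPath x s P := ⟨hP, fun P' hP' =>
    Set.ncard_le_ncard (hPe ▸ (hbd P' hP').1) (Set.toFinite _)⟩
  have hQO : IsOuterPath x s Q := ⟨hQ, fun P' hP' =>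
    Set.ncard_le_ncard (hQe ▸ (hbd P' hP').2) (Set.toFinite _)⟩
  have hIu : ∀ P', IsInnerPath x s P' → P' = P := fun P' hP' => by
    refine hinj _ _ hP'.1 hP ?_
    rw [hPe]
    refine (Set.eq_of_subset_of_ncard_le (hbd P' hP'.1).1 ?_ (Set.toFinite _)).symm
    rw [← hPe]
    exact hP'.2 P hP
  have hOu : ∀ P', IsOuterPath x s P' → P' = Q := fun P' hP' => by
    refine hinj _ _ hP'.1 hQ ?_
    rw [hQe]
    refine Set.eq_of_subset_of_ncard_le (hbd P' hP'.1).2 ?_ (Set.toFinite _)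
    rw [← hQe]
    exact hP'.2 Q hQ
  refine ⟨⟨P, hPI, hIu⟩, ⟨Q, hQO, hOu⟩, ?_, ?_⟩
  · ext v
    constructor
    · rintro ⟨P', hP', hv⟩
      rw [hIu P' hP', hPe] at hv
      exact hv
    · intro hv
      exact ⟨P, hPI, hPe ▸ hv⟩
  · ext v
    constructor
    · rintro ⟨P', hP', hv⟩
      rw [hOu P' hP', hQe] at hv
      exact hv
    · intro hv
      exact ⟨Q, hQO, hQe ▸ hv⟩

theorem mem_closedRegion_compl {x : BoundaryConfig N} {s : ℤˣ} {P : Set (Site N)} {v : Site N} :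
    v ∉ closedRegion x s P ↔ v ∉ P ∪ run x s ∧ ∃ u, u ∈ boundary N ∧ u ∉ P ∪ run x s ∧
      Relation.ReflTransGen (fun a b : Site N => Near a b ∧ b ∉ P ∪ run x s) v u := by
  simp only [closedRegion, Encloses, Set.mem_ofPred_eq]
  by_cases h : v ∈ P ∪ run x s
  · simp only [h, true_or, not_true, false_and]
  · simp only [h, false_or, not_false_eq_true, true_and, not_not]

/-- A set that contains `P ∪ R^s`, whose further sites are near no site outside of the set and not
on the boundary, lies in the closed region. -/
theorem subset_closedRegion {x : BoundaryConfig N} {s : ℤˣ} {P A : Set (Site N)}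
    (hbd : ∀ v ∈ A, v ∈ boundary N → v ∈ P ∪ run x s)
    (hstep : ∀ v ∈ A, v ∉ P ∪ run x s → ∀ w, Near v w → w ∈ A) : A ⊆ closedRegion x s P := by
  intro v hv
  by_contra hcon
  obtain ⟨hvS, u, hu, huS, hgen⟩ := mem_closedRegion_compl.1 hcon
  have key : u ∈ A := by
    clear hcon huS hu
    have : u ∈ A ∧ u ∉ P ∪ run x s := by
      induction hgen with
      | refl => exact ⟨hv, hvS⟩
      | tail _ h ih => exact ⟨hstep _ ih.1 ih.2 _ h.1, h.2⟩
    exact this.1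
  exact huS (hbd u key hu)

/-- A site from which one can go straight up to the boundary outside of `P ∪ R^s` is not in the
closed region. -/
theorem notMem_closedRegion_of_up {x : BoundaryConfig N} {s : ℤˣ} {P : Set (Site N)} {v : Site N}
    (h : ∀ z : Site N, (z.2 : ℕ) = v.2 → (z.1 : ℕ) ≤ v.1 → z ∉ P ∪ run x s) :
    v ∉ closedRegion x s P := by
  have h₁ := v.fst_le
  have h₂ := v.snd_le
  refine mem_closedRegion_compl.2 ⟨h v rfl le_rfl, site N 0 v.2, ?_, ?_, ?_⟩
  · rw [mem_boundary_iff, site_fst (by omega)]; omega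
  · exact h _ (site_snd v.snd_le) (by rw [site_fst (by omega)]; omega)
  · have : ∀ k, k ≤ (v.1 : ℕ) →
        Relation.ReflTransGen (fun a b : Site N => Near a b ∧ b ∉ P ∪ run x s) v
          (site N (v.1 - k) v.2) := by
      intro k
      induction k with
      | zero => intro _; rw [Nat.sub_zero, site_coords]
      | succ k ih =>
        intro hk
        refine (ih (by omega)).tail ⟨?_, h _ (site_snd v.snd_le) ?_⟩
        · simp only [Near, site_fst (show (v.1 : ℕ) - k ≤ N + 1 by omega),
            site_fst (show (v.1 : ℕ) - (k + 1) ≤ N + 1 by omega), site_snd h₂]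
          omega
        · rw [site_fst (by omega)]; omega
    simpa using this v.1 le_rfl

/-- The same for a straight way down. -/
theorem notMem_closedRegion_of_down {x : BoundaryConfig N} {s : ℤˣ} {P : Set (Site N)}
    {v : Site N} (h : ∀ z : Site N, (z.2 : ℕ) = v.2 → (v.1 : ℕ) ≤ z.1 → z ∉ P ∪ run x s) :
    v ∉ closedRegion x s P := by
  have h₁ := v.fst_le
  have h₂ := v.snd_le
  refine mem_closedRegion_compl.2 ⟨h v rfl le_rfl, site N (N + 1) v.2, ?_, ?_, ?_⟩
  · rw [mem_boundary_iff, site_fst (by omega)]; omega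
  · exact h _ (site_snd v.snd_le) (by rw [site_fst (by omega)]; omega)
  · have : ∀ k, (v.1 : ℕ) + k ≤ N + 1 →
        Relation.ReflTransGen (fun a b : Site N => Near a b ∧ b ∉ P ∪ run x s) v
          (site N (v.1 + k) v.2) := by
      intro k
      induction k with
      | zero => intro _; rw [Nat.add_zero, site_coords]
      | succ k ih =>
        intro hk
        refine (ih (by omega)).tail ⟨?_, h _ (site_snd v.snd_le) ?_⟩
        · simp only [Near, site_fst (show (v.1 : ℕ) + k ≤ N + 1 by omega),
            site_fst (show (v.1 : ℕ) + (k + 1) ≤ N + 1 by omega), site_snd h₂]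
          omega
        · rw [site_fst (by omega)]; omega
    have := this (N + 1 - v.1) (by omega)
    rwa [Nat.add_sub_cancel' h₁] at this

/-- Replaces the cardinality condition on neighbours by coordinate statements: no two different
neighbours in the run at `u` and `v`, two explicit ones elsewhere. The case `u = v` of a single site
is included. -/
theorem runEnds_eq_pair {x : BoundaryConfig N} {s : ℤˣ} {u v : Site N}
    (hu : u ∈ run x s) (hv : v ∈ run x s)
    (hu' : ∀ z z', z ∈ run x s → z' ∈ run x s → (grid N).Adj u z → (grid N).Adj u z' → z = z')
    (hv' : ∀ z z', z ∈ run x s → z' ∈ run x s → (grid N).Adj v z → (grid N).Adj v z' → z = z')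
    (h : ∀ w ∈ run x s, w ≠ u → w ≠ v → ∃ z z', z ∈ run x s ∧ z' ∈ run x s ∧
      (grid N).Adj w z ∧ (grid N).Adj w z' ∧ z ≠ z') : runEnds x s = {u, v} := by
  have hle : ∀ w : Site N, ((grid N).neighborSet w ∩ run x s).ncard ≤ 1 ↔
      ∀ z z', z ∈ run x s → z' ∈ run x s → (grid N).Adj w z → (grid N).Adj w z' → z = z' := by
    intro w
    rw [Set.ncard_le_one_iff (Set.toFinite _)]
    exact ⟨fun h z z' h₁ h₂ h₃ h₄ => h ⟨h₃, h₁⟩ ⟨h₄, h₂⟩,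
      fun h z z' h₁ h₂ => h z z' h₁.2 h₂.2 h₁.1 h₂.1⟩
  ext w
  simp only [runEnds, Set.mem_ofPred_eq, Set.mem_insert_iff, Set.mem_singleton_iff, hle]
  constructor
  · rintro ⟨hw, hz⟩
    by_contra! hcon
    obtain ⟨z, z', h₁, h₂, h₃, h₄, h₅⟩ := h w hw hcon.1 hcon.2
    exact h₅ (hz z z' h₁ h₂ h₃ h₄)
  · rintro (rfl | rfl)
    · exact ⟨hu, hu'⟩
    · exact ⟨hv, hv'⟩

/-! ### Runs that contain the lower left corner and not the upper right one -/

/-- The run `R^s` contains the lower left corner but not the upper right one, and its ends `u` (on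
the left or top side) and `v` (on the bottom or right side) satisfy `u ≤ v`. -/
structure IsStaircaseRun (x : BoundaryConfig N) (s : ℤˣ) (u v : Site N) : Prop where
  fst_le : (u.1 : ℕ) ≤ v.1
  snd_le : (u.2 : ℕ) ≤ v.2
  left : (u.1 : ℕ) = 0 ∨ (u.2 : ℕ) = 0
  right : (v.1 : ℕ) = N + 1 ∨ (v.2 : ℕ) = N + 1
  -- This bound and the next one say that neither end is the upper right corner.
  left_le : (u.2 : ℕ) ≤ N
  right_ge : 1 ≤ (v.1 : ℕ)
  mem_run : ∀ w, w ∈ run x s ↔ w ∈ boundary N ∧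
    (((u.1 : ℕ) ≤ w.1 ∧ (w.2 : ℕ) ≤ u.2) ∨ ((v.1 : ℕ) ≤ w.1 ∧ (w.2 : ℕ) ≤ v.2))

/-- The union of the lower left quadrants of the sites of `P`. -/
def lowerLeft (P : Set (Site N)) : Set (Site N) :=
  {w | ∃ p ∈ P, (p.1 : ℕ) ≤ w.1 ∧ (w.2 : ℕ) ≤ p.2}

/-- The sites of a monotone path from `u` to `v`. -/
structure IsStaircase (u v : Site N) (P : Set (Site N)) : Prop where
  between : ∀ z ∈ P, (u.1 : ℕ) ≤ z.1 ∧ (u.2 : ℕ) ≤ z.2 ∧ (z.1 : ℕ) ≤ v.1 ∧ (z.2 : ℕ) ≤ v.2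
  chain : ∀ z ∈ P, ∀ z' ∈ P, ((z.1 : ℕ) ≤ z'.1 ∧ (z.2 : ℕ) ≤ z'.2) ∨
    ((z'.1 : ℕ) ≤ z.1 ∧ (z'.2 : ℕ) ≤ z.2)
  level : ∀ t : ℕ, (u.1 : ℕ) + u.2 ≤ t → t ≤ v.1 + v.2 → ∃ z ∈ P, (z.1 : ℕ) + z.2 = t

/-! ### Monotone paths and the regions to their lower left. -/

namespace IsStaircase

variable {u v : Site N} {P Q : Set (Site N)}

/-- Compare the sites `p` and `q` of the two staircases on the same antidiagonal. If they differ,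
one lies strictly above and to the right of the other; as the regions agree, the other staircase
also has a site there, which is incomparable to its own site on that antidiagonal. -/
theorem subset_of_lowerLeft_eq (hP : IsStaircase u v P) (hQ : IsStaircase u v Q)
    (h : lowerLeft P = lowerLeft Q) : P ⊆ Q := by
  intro p hp
  have hpb := hP.between p hp
  obtain ⟨q, hq, hpq⟩ := hQ.level (p.1 + p.2) (by omega) (by omega)
  obtain ⟨q', hq', hq'p⟩ : p ∈ lowerLeft Q := h ▸ ⟨p, hp, le_rfl, le_rfl⟩
  obtain ⟨p', hp', hp'q⟩ : q ∈ lowerLeft P := h.symm ▸ ⟨q, hq, le_rfl, le_rfl⟩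
  have h₁ := hQ.chain q hq q' hq'
  have h₂ := hP.chain p hp p' hp'
  have : p = q := Site.ext_nat (by omega) (by omega)
  exact this ▸ hq

theorem eq_of_lowerLeft_eq (hP : IsStaircase u v P) (hQ : IsStaircase u v Q)
    (h : lowerLeft P = lowerLeft Q) : P = Q :=
  (hP.subset_of_lowerLeft_eq hQ h).antisymm (hQ.subset_of_lowerLeft_eq hP h.symm)

theorem left_mem (hP : IsStaircase u v P) (h₁ : (u.1 : ℕ) ≤ v.1) (h₂ : (u.2 : ℕ) ≤ v.2) :
    u ∈ P := by
  obtain ⟨z, hz, ht⟩ := hP.level (u.1 + u.2) le_rfl (by omega)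
  have := hP.between z hz
  have : u = z := Site.ext_nat (by omega) (by omega)
  exact this ▸ hz

theorem right_mem (hP : IsStaircase u v P) (h₁ : (u.1 : ℕ) ≤ v.1) (h₂ : (u.2 : ℕ) ≤ v.2) :
    v ∈ P := by
  obtain ⟨z, hz, ht⟩ := hP.level (v.1 + v.2) (by omega) le_rfl
  have := hP.between z hz
  have : v = z := Site.ext_nat (by omega) (by omega)
  exact this ▸ hz

/-- A site of the lower left region that is not on the staircase lies strictly below and to the
left of a site of the staircase, unless it is level with one of the ends. -/
theorem exists_strict (hP : IsStaircase u v P) {a : Site N} (ha : a ∈ lowerLeft P) (haP : a ∉ P) :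
    (∃ p ∈ P, (p.1 : ℕ) < a.1 ∧ (a.2 : ℕ) < p.2) ∨ ((a.1 : ℕ) = u.1 ∧ (a.2 : ℕ) < u.2) ∨
      ((a.2 : ℕ) = v.2 ∧ (v.1 : ℕ) < a.1) := by
  by_contra! hcon
  obtain ⟨hno, hu, hv⟩ := hcon
  have hrow : ∀ n, ∀ p ∈ P, (p.1 : ℕ) = a.1 → (p.2 : ℕ) ≠ a.2 + n := by
    intro n
    induction n with
    | zero =>
      intro p hp h₁ h₂
      exact haP ((Site.ext_nat h₁ h₂ : p = a) ▸ hp)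
    | succ n ih =>
      intro p hp h₁ h₂
      have hb := hP.between p hp
      obtain ⟨q, hq, hqt⟩ := hP.level (a.1 + (a.2 + n)) (by omega) (by omega)
      have h₃ := hP.chain p hp q hq
      have h₄ := hno q hq
      have h₅ := ih q hq
      omega
  have hcol : ∀ n, ∀ p ∈ P, (p.2 : ℕ) = a.2 → (a.1 : ℕ) ≠ p.1 + n := by
    intro n
    induction n with
    | zero =>
      intro p hp h₁ h₂
      exact haP ((Site.ext_nat h₂ h₁.symm : a = p) ▸ hp)
    | succ n ih =>
      intro p hp h₁ h₂
      have hb := hP.between p hp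
      obtain ⟨q, hq, hqt⟩ := hP.level (p.1 + 1 + p.2) (by omega) (by omega)
      have h₃ := hP.chain p hp q hq
      have h₄ := hno q hq
      have h₅ := ih q hq
      omega
  obtain ⟨p, hp, h₁, h₂⟩ := ha
  have h₃ := hno p hp
  have h₄ := hrow (p.2 - a.2) p hp
  have h₅ := hcol (a.1 - p.1) p hp
  omega

end IsStaircase

/-! ### Cores, simple paths and closed regions for staircase runs. -/

namespace IsStaircaseRun

variable {x : BoundaryConfig N} {s : ℤˣ} {u v : Site N}

theorem left_mem_run (h : IsStaircaseRun x s u v) : u ∈ run x s := by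
  have := h.left
  rw [h.mem_run, mem_boundary_iff]
  omega

theorem right_mem_run (h : IsStaircaseRun x s u v) : v ∈ run x s := by
  have := h.right
  rw [h.mem_run, mem_boundary_iff]
  omega

theorem runEnds_eq (h : IsStaircaseRun x s u v) : runEnds x s = {u, v} := by
  have h₁ := h.fst_le
  have h₂ := h.snd_le
  have h₃ := h.left
  have h₄ := h.right
  have h₅ := h.left_le
  have h₆ := h.right_ge
  have h₇ := v.fst_le
  have h₈ := v.snd_le
  refine runEnds_eq_pair h.left_mem_run h.right_mem_run ?_ ?_ ?_
  · intro z z'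
    have := z.fst_le
    have := z.snd_le
    have := z'.fst_le
    have := z'.snd_le
    rw [h.mem_run, h.mem_run, mem_boundary_iff, mem_boundary_iff, grid_adj_iff, grid_adj_iff]
    intro hz hz' ha ha'
    refine Site.ext_nat ?_ ?_ <;> omega
  · intro z z'
    have := z.fst_le
    have := z.snd_le
    have := z'.fst_le
    have := z'.snd_le
    rw [h.mem_run, h.mem_run, mem_boundary_iff, mem_boundary_iff, grid_adj_iff, grid_adj_iff]
    intro hz hz' ha ha'
    refine Site.ext_nat ?_ ?_ <;> omega
  · intro w hw hwu hwv
    rw [h.mem_run, mem_boundary_iff] at hw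
    have hw₁ := w.fst_le
    have hw₂ := w.snd_le
    have hu' : ¬ ((w.1 : ℕ) = u.1 ∧ (w.2 : ℕ) = u.2) := fun h => hwu (Site.ext_nat h.1 h.2)
    have hv' : ¬ ((w.1 : ℕ) = v.1 ∧ (w.2 : ℕ) = v.2) := fun h => hwv (Site.ext_nat h.1 h.2)
    -- The two neighbours on the boundary cycle, in plain coordinates. They turn a corner where `w`
    -- is a corner; the upper right corner needs no case because it is not in the run.
    have key : ∃ i j i' j', i ≤ N + 1 ∧ j ≤ N + 1 ∧ i' ≤ N + 1 ∧ j' ≤ N + 1 ∧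
        (i = 0 ∨ i = N + 1 ∨ j = 0 ∨ j = N + 1) ∧
        (i' = 0 ∨ i' = N + 1 ∨ j' = 0 ∨ j' = N + 1) ∧
        (((u.1 : ℕ) ≤ i ∧ j ≤ u.2) ∨ ((v.1 : ℕ) ≤ i ∧ j ≤ v.2)) ∧
        (((u.1 : ℕ) ≤ i' ∧ j' ≤ u.2) ∨ ((v.1 : ℕ) ≤ i' ∧ j' ≤ v.2)) ∧
        ((((w.1 : ℕ) + 1 = i ∨ i + 1 = w.1) ∧ (w.2 : ℕ) = j) ∨
          (((w.2 : ℕ) + 1 = j ∨ j + 1 = w.2) ∧ (w.1 : ℕ) = i)) ∧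
        ((((w.1 : ℕ) + 1 = i' ∨ i' + 1 = w.1) ∧ (w.2 : ℕ) = j') ∨
          (((w.2 : ℕ) + 1 = j' ∨ j' + 1 = w.2) ∧ (w.1 : ℕ) = i')) ∧ ¬ (i = i' ∧ j = j') := by
      rcases Nat.eq_zero_or_pos (w.2 : ℕ) with hj | hj
      · rcases Nat.eq_zero_or_pos (w.1 : ℕ) with hi | hi
        · exact ⟨1, 0, 0, 1, by omega⟩
        · rcases Nat.lt_or_ge (w.1 : ℕ) (N + 1) with hi' | hi'
          · exact ⟨w.1 - 1, 0, w.1 + 1, 0, by omega⟩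
          · exact ⟨N, 0, N + 1, 1, by omega⟩
      · rcases Nat.lt_or_ge (w.2 : ℕ) (N + 1) with hj' | hj'
        · exact ⟨w.1, w.2 - 1, w.1, w.2 + 1, by omega⟩
        · rcases Nat.lt_or_ge (w.1 : ℕ) (N + 1) with hi' | hi'
          · exact ⟨w.1 - 1, w.2, w.1 + 1, w.2, by omega⟩
          · exact ⟨N, N + 1, N + 1, N, by omega⟩
    obtain ⟨i, j, i', j', hi, hj, hi', hj', k₁, k₂, k₃, k₄, k₅, k₆, k₇⟩ := key
    refine ⟨site N i j, site N i' j', ?_, ?_, ?_, ?_, ?_⟩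
    · rw [h.mem_run, mem_boundary_iff, site_fst hi, site_snd hj]; exact ⟨k₁, k₃⟩
    · rw [h.mem_run, mem_boundary_iff, site_fst hi', site_snd hj']; exact ⟨k₂, k₄⟩
    · rw [grid_adj_iff, site_fst hi, site_snd hj]; exact k₅
    · rw [grid_adj_iff, site_fst hi', site_snd hj']; exact k₆
    · intro he
      refine k₇ ⟨?_, ?_⟩
      · rw [← site_fst hi, he, site_fst hi']
      · rw [← site_snd hj, he, site_snd hj']

/-- The core is the union of the lower left quadrants of the two ends, that is, the region under the
path that goes down the column of `u` and then along the row of `v`. -/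
theorem mem_core_iff (h : IsStaircaseRun x s u v) (w : Site N) : w ∈ core x s ↔
    ((u.1 : ℕ) ≤ w.1 ∧ (w.2 : ℕ) ≤ u.2) ∨ ((v.1 : ℕ) ≤ w.1 ∧ (w.2 : ℕ) ≤ v.2) := by
  have h₁ := h.fst_le
  have h₂ := h.snd_le
  have h₃ := h.left
  have h₄ := h.right
  have h₅ := h.left_le
  have h₆ := h.right_ge
  have h₇ := v.fst_le
  have h₈ := v.snd_le
  have h₉ := w.fst_le
  have h₀ := w.snd_le
  simp only [core, Set.mem_ofPred_eq, h.mem_run, mem_boundary_iff, mem_interior_iff,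
    site_fst h₉, site_snd h₀, site_fst (Nat.zero_le (N + 1)), site_fst (le_refl (N + 1)),
    site_snd (Nat.zero_le (N + 1)), site_snd (le_refl (N + 1)), true_or, or_true, true_and]
  omega

/-- The interior lines with both ends in `R^{-s}` are the rows above `u` and the columns to the
right of `v`. What remains in the interior is the lower left quadrant of the corner where the row of
`u` meets the column of `v`. -/
theorem mem_core_neg_iff (h : IsStaircaseRun x s u v) (w : Site N) : w ∈ core x (-s) ↔
    ¬ (w ∈ run x s ∨ w ∈ interior N ∧ (u.1 : ℕ) ≤ w.1 ∧ (w.2 : ℕ) ≤ v.2) := by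
  have h₁ := h.fst_le
  have h₂ := h.snd_le
  have h₃ := h.left
  have h₄ := h.right
  have h₅ := h.left_le
  have h₆ := h.right_ge
  have h₇ := v.fst_le
  have h₈ := v.snd_le
  have h₉ := w.fst_le
  have h₀ := w.snd_le
  simp only [core, Set.mem_ofPred_eq, mem_run_neg_iff, h.mem_run, mem_boundary_iff,
    mem_interior_iff,
    site_fst h₉, site_snd h₀, site_fst (Nat.zero_le (N + 1)), site_fst (le_refl (N + 1)),
    site_snd (Nat.zero_le (N + 1)), site_snd (le_refl (N + 1)), true_or, or_true, true_and]
  omega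

theorem lowerLeft_inter_boundary (h : IsStaircaseRun x s u v) {P : Set (Site N)}
    (hP : IsStaircase u v P) (hA : ∀ z ∈ P, z ∈ interior N ∪ run x s) {w : Site N}
    (hw : w ∈ lowerLeft P) (hwb : w ∈ boundary N) : w ∈ run x s := by
  obtain ⟨p, hp, hpw⟩ := hw
  have hb := hP.between p hp
  have hpA := hA p hp
  have h₃ := p.fst_le
  have h₄ := p.snd_le
  have h₅ := w.fst_le
  have h₆ := w.snd_le
  simp only [Set.mem_union, h.mem_run, mem_interior_iff, mem_boundary_iff] at hpA hwb ⊢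
  omega

/-- From a site outside the lower left region one can go straight up without meeting it, so such a
site is not enclosed. A site of the region that is on neither the path nor the run lies strictly
below and to the left of a path site, so that even diagonal steps stay in the region. -/
theorem closedRegion_eq (h : IsStaircaseRun x s u v) {P : Set (Site N)}
    (hP : IsStaircase u v P) (hA : ∀ z ∈ P, z ∈ interior N ∪ run x s) :
    closedRegion x s P = lowerLeft P := by
  have hPsub : P ∪ run x s ⊆ lowerLeft P := by
    rintro w (hw | hw)
    · exact ⟨w, hw, le_rfl, le_rfl⟩
    · rcases ((h.mem_run w).1 hw).2 with hw | hw
      · exact ⟨u, hP.left_mem h.fst_le h.snd_le, hw⟩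
      · exact ⟨v, hP.right_mem h.fst_le h.snd_le, hw⟩
  apply Set.Subset.antisymm
  · intro w hw
    by_contra hcon
    refine notMem_closedRegion_of_up (fun z hz₁ hz₂ hz => hcon ?_) hw
    obtain ⟨p, hp, h₁, h₂⟩ := hPsub hz
    exact ⟨p, hp, by omega, by omega⟩
  · refine subset_closedRegion ?_ ?_
    · intro w hw hwb
      exact Or.inr (h.lowerLeft_inter_boundary hP hA hw hwb)
    · intro a ha haS b hab
      simp only [Set.mem_union, not_or, h.mem_run, mem_boundary_iff] at haS
      have h₁ := h.left
      have h₂ := h.right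
      obtain ⟨h₃, h₄, h₅, h₆⟩ := hab
      rcases hP.exists_strict ha haS.1 with ⟨p, hp, h₇, h₈⟩ | h₇ | h₇
      · exact ⟨p, hp, by omega, by omega⟩
      · omega
      · have := a.fst_le
        omega

/-- The rectangle spanned by `u` and `v` contains forbidden boundary sites only in the top row to
the right of `u` and in the right column above `v`. The last two hypotheses exclude these. -/
theorem mem_allowed (h : IsStaircaseRun x s u v) {z : Site N}
    (hz : (u.1 : ℕ) ≤ z.1 ∧ (u.2 : ℕ) ≤ z.2 ∧ (z.1 : ℕ) ≤ v.1 ∧ (z.2 : ℕ) ≤ v.2)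
    (h₁ : 1 ≤ (z.1 : ℕ) ∨ (z.2 : ℕ) = u.2) (h₂ : (z.2 : ℕ) ≤ N ∨ (z.1 : ℕ) = v.1) :
    z ∈ interior N ∪ run x s := by
  have h₃ := z.fst_le
  have h₄ := z.snd_le
  simp only [Set.mem_union, h.mem_run, mem_interior_iff, mem_boundary_iff]
  omega

/-- The path that goes from `u` along the column of `u` to row `i`, along this row to column `j`,
along this column to the row of `v`, and along this row to `v`. -/
theorem exists_walk (h : IsStaircaseRun x s u v) {i j : ℕ} (hi : (u.1 : ℕ) ≤ i) (hi' : i ≤ v.1)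
    (hj : (u.2 : ℕ) ≤ j) (hj' : j ≤ v.2) (hi₁ : 1 ≤ i) (hj₁ : j ≤ N ∨ i = v.1) :
    ∃ w : (grid N).Walk u v, w.length + u.1 + u.2 = v.1 + v.2 ∧
      (∀ z ∈ w.support, z ∈ interior N ∪ run x s) ∧ site N i j ∈ w.support ∧
      ∀ z ∈ w.support, (z.2 : ℕ) = u.2 ∨ i ≤ z.1 := by
  have hv₁ := v.fst_le
  have hv₂ := v.snd_le
  have hr := h.right_ge
  have hl := h.left_le
  obtain ⟨w₁, hl₁, hs₁⟩ := exists_vertical_walk (N := N) (j := u.2) hi (by omega) u.snd_le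
  obtain ⟨w₂, hl₂, hs₂⟩ := exists_horizontal_walk (N := N) (i := i) hj (by omega) (by omega)
  obtain ⟨w₃, hl₃, hs₃⟩ := exists_vertical_walk (N := N) (j := j) hi' (by omega) (by omega)
  obtain ⟨w₄, hl₄, hs₄⟩ := exists_horizontal_walk (N := N) (i := v.1) hj' (by omega) (by omega)
  refine ⟨(((w₁.append w₂).append w₃).append w₄).copy (site_coords u) (site_coords v),
    ?_, ?_, ?_, ?_⟩
  · simp only [SimpleGraph.Walk.length_copy, SimpleGraph.Walk.length_append]
    omega
  · intro z hz
    simp only [SimpleGraph.Walk.support_copy, SimpleGraph.Walk.mem_support_append_iff, hs₁, hs₂,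
      hs₃, hs₄] at hz
    refine h.mem_allowed ?_ ?_ ?_ <;> omega
  · simp only [SimpleGraph.Walk.support_copy, SimpleGraph.Walk.mem_support_append_iff]
    exact Or.inl (Or.inr w₃.start_mem_support)
  · intro z hz
    simp only [SimpleGraph.Walk.support_copy, SimpleGraph.Walk.mem_support_append_iff, hs₁, hs₂,
      hs₃, hs₄] at hz
    omega

/-- An admissible walk attains the l¹-distance of the ends, so the simple paths are the admissible
geodesics, and these are monotone. -/
theorem isSimplePath_iff_isStaircase (h : IsStaircaseRun x s u v) :
    (∀ P, IsSimplePath x s P → IsStaircase u v P ∧ ∀ z ∈ P, z ∈ interior N ∪ run x s) ∧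
      ∀ w : (grid N).Walk u v, w.length + u.1 + u.2 = v.1 + v.2 →
        (∀ z ∈ w.support, z ∈ interior N ∪ run x s) → IsSimplePath x s {z | z ∈ w.support} := by
  obtain ⟨w₀, hw₀, hA₀, -⟩ := h.exists_walk h.fst_le le_rfl le_rfl h.snd_le h.right_ge (Or.inr rfl)
  have hmin : ∀ w : (grid N).Walk u v, (∀ z ∈ w.support, z ∈ interior N ∪ run x s) →
      w₀.length ≤ w.length := fun w _ => by
    have := walk_length_bounds w
    omega
  have key := isSimplePath_iff h.runEnds_eq w₀ hA₀ hmin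
  constructor
  · intro P hP
    obtain ⟨w, -, hA, hl, rfl⟩ := (key P).1 hP
    obtain ⟨h₁, h₂, h₃⟩ := geodesic_support w h.fst_le h.snd_le (by omega)
    exact ⟨⟨h₁, h₂, h₃⟩, hA⟩
  · intro w hl hA
    have hlen : w.length = w₀.length := by omega
    exact (key _).2 ⟨w, isPath_of_length_minimal w hA (hlen ▸ hmin), hA, hlen, rfl⟩

theorem pathsBoundCores (h : IsStaircaseRun x s u v) : PathsBoundCores x s := by
  obtain ⟨hst, hsimple⟩ := h.isSimplePath_iff_isStaircase
  have h₁ := h.fst_le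
  have h₂ := h.snd_le
  have h₃ := h.left
  have h₄ := h.right
  have h₅ := h.left_le
  have h₆ := h.right_ge
  refine pathsBoundCores_of ?_ ?_ ?_ ?_
  · intro P hP
    obtain ⟨hPs, hPA⟩ := hst P hP
    rw [h.closedRegion_eq hPs hPA]
    constructor
    · intro w hw
      rcases (h.mem_core_iff w).1 hw with hw | hw
      · exact ⟨u, hPs.left_mem h₁ h₂, hw⟩
      · exact ⟨v, hPs.right_mem h₁ h₂, hw⟩
    · intro w hw
      rw [Set.mem_compl_iff, h.mem_core_neg_iff, not_not]
      by_cases hwb : w ∈ interior N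
      · right
        obtain ⟨p, hp, hpw⟩ := hw
        have := hPs.between p hp
        exact ⟨hwb, by omega, by omega⟩
      · exact Or.inl (h.lowerLeft_inter_boundary hPs hPA hw hwb)
  · intro P Q hP hQ he
    obtain ⟨hPs, hPA⟩ := hst P hP
    obtain ⟨hQs, hQA⟩ := hst Q hQ
    rw [h.closedRegion_eq hPs hPA, h.closedRegion_eq hQs hQA] at he
    exact hPs.eq_of_lowerLeft_eq hQs he
  -- The inner path turns at the row of `v` and the column of `u`, the lower left corner of the
  -- rectangle.
  · obtain ⟨w, hl, hA, -, hs⟩ := h.exists_walk h₁ le_rfl le_rfl h₂ h₆ (Or.inr rfl)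
    have hP := hsimple w hl hA
    obtain ⟨hPs, hPA⟩ := hst _ hP
    refine ⟨_, hP, ?_⟩
    rw [h.closedRegion_eq hPs hPA]
    rintro z ⟨p, hp, hpz⟩
    have := hs p hp
    have := hPs.between p hp
    rw [h.mem_core_iff]
    omega
  -- The outer path turns at the upper right corner of the rectangle, moved into row 1 or column `N`
  -- where that corner would use the top row or the right column.
  · obtain ⟨w, hl, hA, hm, -⟩ := h.exists_walk (i := max u.1 1) (j := min v.2 N) (by omega)
      (by omega) (by omega) (by omega) (by omega) (by omega)
    have hP := hsimple w hl hA
    obtain ⟨hPs, hPA⟩ := hst _ hP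
    refine ⟨_, hP, ?_⟩
    rw [h.closedRegion_eq hPs hPA]
    intro z hz
    rw [Set.mem_compl_iff, h.mem_core_neg_iff, not_not, h.mem_run, mem_interior_iff] at hz
    rcases hz with ⟨-, hz | hz⟩ | hz
    · exact ⟨u, hPs.left_mem h₁ h₂, hz⟩
    · exact ⟨v, hPs.right_mem h₁ h₂, hz⟩
    · have := v.fst_le
      have := v.snd_le
      refine ⟨_, hm, ?_⟩
      rw [site_fst (by omega), site_snd (by omega)]
      omega

end IsStaircaseRun

/-! ### Runs within the top side, and their complements -/

/-- The run `R^s` consists of the sites in the columns `a, …, b` of the top row, with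
`1 ≤ a ≤ b ≤ N`. -/
structure IsTopRun (x : BoundaryConfig N) (s : ℤˣ) (a b : ℕ) : Prop where
  one_le : 1 ≤ a
  le : a ≤ b
  le_N : b ≤ N
  mem_run : ∀ w, w ∈ run x s ↔ (w.1 : ℕ) = 0 ∧ a ≤ (w.2 : ℕ) ∧ (w.2 : ℕ) ≤ b

namespace IsTopRun

variable {x : BoundaryConfig N} {s : ℤˣ} {a b : ℕ}

theorem mem_run_neg (h : IsTopRun x s a b) (w : Site N) : w ∈ run x (-s) ↔
    w ∈ boundary N ∧ ¬ ((w.1 : ℕ) = 0 ∧ a ≤ (w.2 : ℕ) ∧ (w.2 : ℕ) ≤ b) := by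
  rw [mem_run_neg_iff, h.mem_run]

theorem core_eq (h : IsTopRun x s a b) : core x s = run x s := by
  have h₁ := h.one_le
  have h₂ := h.le
  have h₃ := h.le_N
  ext w
  have h₉ := w.fst_le
  have h₀ := w.snd_le
  simp only [core, Set.mem_ofPred_eq, h.mem_run, mem_interior_iff,
    site_fst h₉, site_snd h₀, site_fst (Nat.zero_le (N + 1)), site_fst (le_refl (N + 1)),
    site_snd (Nat.zero_le (N + 1)), site_snd (le_refl (N + 1)), true_and]
  omega

/-- Every interior row has both ends in `R^{-s}`. The two cores therefore partition the grid, and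
inner and outer paths of each sign coincide. -/
theorem core_neg_eq (h : IsTopRun x s a b) : core x (-s) = (run x s)ᶜ := by
  have h₁ := h.one_le
  have h₂ := h.le
  have h₃ := h.le_N
  ext w
  have h₉ := w.fst_le
  have h₀ := w.snd_le
  simp only [core, Set.mem_ofPred_eq, Set.mem_compl_iff, h.mem_run_neg, h.mem_run,
    mem_interior_iff, mem_boundary_iff,
    site_fst h₉, site_snd h₀, site_fst (Nat.zero_le (N + 1)), site_fst (le_refl (N + 1)),
    site_snd (Nat.zero_le (N + 1)), site_snd (le_refl (N + 1)), true_or, or_true, true_and]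
  omega

theorem runEnds_eq (h : IsTopRun x s a b) : runEnds x s = {site N 0 a, site N 0 b} := by
  have h₁ := h.one_le
  have h₂ := h.le
  have h₃ := h.le_N
  refine runEnds_eq_pair ?_ ?_ ?_ ?_ ?_
  · rw [h.mem_run, site_fst (by omega), site_snd (by omega)]; omega
  · rw [h.mem_run, site_fst (by omega), site_snd (by omega)]; omega
  · intro z z'
    rw [h.mem_run, h.mem_run, grid_adj_iff, grid_adj_iff, site_fst (by omega),
      site_snd (by omega)]
    intro hz hz' ha ha'
    refine Site.ext_nat ?_ ?_ <;> omega
  · intro z z'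
    rw [h.mem_run, h.mem_run, grid_adj_iff, grid_adj_iff, site_fst (by omega),
      site_snd (by omega)]
    intro hz hz' ha ha'
    refine Site.ext_nat ?_ ?_ <;> omega
  · intro w hw hwu hwv
    rw [h.mem_run] at hw
    have hu : (w.2 : ℕ) ≠ a := fun h => hwu (eq_site hw.1 h)
    have hv : (w.2 : ℕ) ≠ b := fun h => hwv (eq_site hw.1 h)
    refine ⟨site N 0 (w.2 - 1), site N 0 (w.2 + 1), ?_, ?_, ?_, ?_, ?_⟩
    · rw [h.mem_run, site_fst (by omega), site_snd (by omega)]; omega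
    · rw [h.mem_run, site_fst (by omega), site_snd (by omega)]; omega
    · rw [grid_adj_iff, site_fst (by omega), site_snd (by omega)]; omega
    · rw [grid_adj_iff, site_fst (by omega), site_snd (by omega)]; omega
    · intro he
      have := congrArg (fun z : Site N => (z.2 : ℕ)) he
      simp only [site_snd (show (w.2 : ℕ) - 1 ≤ N + 1 by omega),
        site_snd (show (w.2 : ℕ) + 1 ≤ N + 1 by omega)] at this
      omega

/-- A geodesic between two sites of the same row cannot leave that row. -/
theorem isSimplePath_iff_eq_run (h : IsTopRun x s a b) (P : Set (Site N)) :
    IsSimplePath x s P ↔ P = run x s := by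
  have h₁ := h.one_le
  have h₂ := h.le
  have h₃ := h.le_N
  have ha₁ : ((site N 0 a).1 : ℕ) = 0 := site_fst (by omega)
  have ha₂ : ((site N 0 a).2 : ℕ) = a := site_snd (by omega)
  have hb₁ : ((site N 0 b).1 : ℕ) = 0 := site_fst (by omega)
  have hb₂ : ((site N 0 b).2 : ℕ) = b := site_snd (by omega)
  obtain ⟨w₀, hl₀, hs₀⟩ := exists_horizontal_walk (N := N) (i := 0) h₂ (by omega) (by omega)
  have hA₀ : ∀ z ∈ w₀.support, z ∈ interior N ∪ run x s := fun z hz =>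
    Or.inr ((h.mem_run z).2 ((hs₀ z).1 hz))
  have hmin : ∀ w : (grid N).Walk (site N 0 a) (site N 0 b),
      (∀ z ∈ w.support, z ∈ interior N ∪ run x s) → w₀.length ≤ w.length := fun w _ => by
    have := walk_length_bounds w
    omega
  rw [isSimplePath_iff h.runEnds_eq w₀ hA₀ hmin P]
  constructor
  · rintro ⟨w, -, -, hl, rfl⟩
    obtain ⟨k₁, k₂, k₃⟩ := geodesic_support w (by omega) (by omega) (by omega)
    ext z
    rw [Set.mem_ofPred_eq, h.mem_run]
    constructor
    · intro hz
      have := k₁ z hz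
      omega
    · intro hz
      obtain ⟨z', hz', ht⟩ := k₃ (z.1 + z.2) (by omega) (by omega)
      have := k₁ z' hz'
      have : z = z' := Site.ext_nat (by omega) (by omega)
      exact this ▸ hz'
  · rintro rfl
    refine ⟨w₀, isPath_of_length_minimal w₀ hA₀ hmin, hA₀, rfl, ?_⟩
    ext z
    rw [Set.mem_ofPred_eq, h.mem_run, hs₀]

theorem pathsBoundCores (h : IsTopRun x s a b) : PathsBoundCores x s := by
  have hreg : closedRegion x s (run x s) = run x s := by
    apply Set.Subset.antisymm
    · intro w hw
      by_contra hcon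
      refine notMem_closedRegion_of_down (fun z hz₁ hz₂ hz => hcon ?_) hw
      rw [Set.union_self, h.mem_run] at hz
      rw [h.mem_run]
      omega
    · intro w hw
      exact Or.inl (Or.inl hw)
  refine pathsBoundCores_of ?_ ?_ ?_ ?_
  · intro P hP
    rw [(h.isSimplePath_iff_eq_run P).1 hP, hreg, h.core_eq, h.core_neg_eq, compl_compl]
    exact ⟨le_rfl, le_rfl⟩
  · intro P Q hP hQ _
    rw [(h.isSimplePath_iff_eq_run P).1 hP, (h.isSimplePath_iff_eq_run Q).1 hQ]
  · exact ⟨run x s, (h.isSimplePath_iff_eq_run _).2 rfl, by rw [hreg, h.core_eq]⟩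
  · exact ⟨run x s, (h.isSimplePath_iff_eq_run _).2 rfl,
      by rw [hreg, h.core_neg_eq, compl_compl]⟩

/-! #### The complementary run -/

theorem runEnds_neg_eq (h : IsTopRun x s a b) :
    runEnds x (-s) = {site N 0 (a - 1), site N 0 (b + 1)} := by
  have h₁ := h.one_le
  have h₂ := h.le
  have h₃ := h.le_N
  have ha₁ : ((site N 0 (a - 1)).1 : ℕ) = 0 := site_fst (by omega)
  have ha₂ : ((site N 0 (a - 1)).2 : ℕ) = a - 1 := site_snd (by omega)
  have hb₁ : ((site N 0 (b + 1)).1 : ℕ) = 0 := site_fst (by omega)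
  have hb₂ : ((site N 0 (b + 1)).2 : ℕ) = b + 1 := site_snd (by omega)
  refine runEnds_eq_pair ?_ ?_ ?_ ?_ ?_
  · rw [h.mem_run_neg, mem_boundary_iff]; omega
  · rw [h.mem_run_neg, mem_boundary_iff]; omega
  · intro z z'
    rw [h.mem_run_neg, h.mem_run_neg, mem_boundary_iff, mem_boundary_iff, grid_adj_iff,
      grid_adj_iff]
    intro hz hz' ha ha'
    refine Site.ext_nat ?_ ?_ <;> omega
  · intro z z'
    have := z.snd_le
    have := z'.snd_le
    rw [h.mem_run_neg, h.mem_run_neg, mem_boundary_iff, mem_boundary_iff, grid_adj_iff,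
      grid_adj_iff]
    intro hz hz' ha ha'
    refine Site.ext_nat ?_ ?_ <;> omega
  · intro w hw hwu hwv
    rw [h.mem_run_neg, mem_boundary_iff] at hw
    have hw₁ := w.fst_le
    have hw₂ := w.snd_le
    have hu' : ¬ ((w.1 : ℕ) = 0 ∧ (w.2 : ℕ) = a - 1) := fun h => hwu (eq_site h.1 h.2)
    have hv' : ¬ ((w.1 : ℕ) = 0 ∧ (w.2 : ℕ) = b + 1) := fun h => hwv (eq_site h.1 h.2)
    have key : ∃ i j i' j', i ≤ N + 1 ∧ j ≤ N + 1 ∧ i' ≤ N + 1 ∧ j' ≤ N + 1 ∧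
        (i = 0 ∨ i = N + 1 ∨ j = 0 ∨ j = N + 1) ∧
        (i' = 0 ∨ i' = N + 1 ∨ j' = 0 ∨ j' = N + 1) ∧
        ¬ (i = 0 ∧ a ≤ j ∧ j ≤ b) ∧ ¬ (i' = 0 ∧ a ≤ j' ∧ j' ≤ b) ∧
        ((((w.1 : ℕ) + 1 = i ∨ i + 1 = w.1) ∧ (w.2 : ℕ) = j) ∨
          (((w.2 : ℕ) + 1 = j ∨ j + 1 = w.2) ∧ (w.1 : ℕ) = i)) ∧
        ((((w.1 : ℕ) + 1 = i' ∨ i' + 1 = w.1) ∧ (w.2 : ℕ) = j') ∨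
          (((w.2 : ℕ) + 1 = j' ∨ j' + 1 = w.2) ∧ (w.1 : ℕ) = i')) ∧ ¬ (i = i' ∧ j = j') := by
      rcases Nat.eq_zero_or_pos (w.2 : ℕ) with hj | hj
      · rcases Nat.eq_zero_or_pos (w.1 : ℕ) with hi | hi
        · exact ⟨1, 0, 0, 1, by omega⟩
        · rcases Nat.lt_or_ge (w.1 : ℕ) (N + 1) with hi' | hi'
          · exact ⟨w.1 - 1, 0, w.1 + 1, 0, by omega⟩
          · exact ⟨N, 0, N + 1, 1, by omega⟩
      · rcases Nat.lt_or_ge (w.2 : ℕ) (N + 1) with hj' | hj'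
        · exact ⟨w.1, w.2 - 1, w.1, w.2 + 1, by omega⟩
        · rcases Nat.eq_zero_or_pos (w.1 : ℕ) with hi | hi
          · exact ⟨1, N + 1, 0, N, by omega⟩
          · rcases Nat.lt_or_ge (w.1 : ℕ) (N + 1) with hi' | hi'
            · exact ⟨w.1 - 1, w.2, w.1 + 1, w.2, by omega⟩
            · exact ⟨N, N + 1, N + 1, N, by omega⟩
    obtain ⟨i, j, i', j', hi, hj, hi', hj', k₁, k₂, k₃, k₄, k₅, k₆, k₇⟩ := key
    refine ⟨site N i j, site N i' j', ?_, ?_, ?_, ?_, ?_⟩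
    · rw [h.mem_run_neg, mem_boundary_iff, site_fst hi, site_snd hj]; exact ⟨k₁, k₃⟩
    · rw [h.mem_run_neg, mem_boundary_iff, site_fst hi', site_snd hj']; exact ⟨k₂, k₄⟩
    · rw [grid_adj_iff, site_fst hi, site_snd hj]; exact k₅
    · rw [grid_adj_iff, site_fst hi', site_snd hj']; exact k₆
    · intro he
      refine k₇ ⟨?_, ?_⟩
      · rw [← site_fst hi, he, site_fst hi']
      · rw [← site_snd hj, he, site_snd hj']

end IsTopRun

/-- A function that grows by at most one along the edges within `A` bounds the length of the walks
within `A`. -/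
theorem le_add_length_of_lipschitz {V : Type*} {G : SimpleGraph V} {A : Set V} {f : V → ℕ}
    (hf : ∀ z ∈ A, ∀ z' ∈ A, G.Adj z z' → f z' ≤ f z + 1) {u v : V} (w : G.Walk u v)
    (hA : ∀ z ∈ w.support, z ∈ A) : f v ≤ f u + w.length := by
  induction w with
  | nil => simp
  | @cons u u' v h w ih =>
    have h₁ := ih fun z hz => hA z (by simp [hz])
    have h₂ := hf u (hA u (by simp)) u' (hA u' (by simp)) h
    rw [SimpleGraph.Walk.length_cons]
    omega

/-- `f` and `g` play the roles of lower bounds for the distances within `A` to the two ends.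
Splitting the walk at `z` confines short walks to the sites where `f + g` is small. -/
theorem add_le_length_of_lipschitz {V : Type*} {G : SimpleGraph V} {A : Set V} {f g : V → ℕ}
    (hf : ∀ z ∈ A, ∀ z' ∈ A, G.Adj z z' → f z' ≤ f z + 1)
    (hg : ∀ z ∈ A, ∀ z' ∈ A, G.Adj z z' → g z' ≤ g z + 1) {u v : V} (hu : f u = 0) (hv : g v = 0)
    (w : G.Walk u v) (hA : ∀ z ∈ w.support, z ∈ A) {z : V} (hz : z ∈ w.support) :
    f z + g z ≤ w.length := by
  classical
  have h₁ := le_add_length_of_lipschitz hf (w.takeUntil z hz) fun y hy =>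
    hA y (w.support_takeUntil_subset_support hz hy)
  have h₂ := le_add_length_of_lipschitz hg (w.dropUntil z hz).reverse fun y hy =>
    hA y (w.support_dropUntil_subset_support hz (by simpa using hy))
  have h₃ := congrArg SimpleGraph.Walk.length (w.take_spec hz)
  rw [SimpleGraph.Walk.length_append] at h₃
  rw [SimpleGraph.Walk.length_reverse] at h₂
  omega

theorem ncard_support_of_isPath {V : Type*} {G : SimpleGraph V} {u v : V} {w : G.Walk u v}
    (hw : w.IsPath) : {z | z ∈ w.support}.ncard = w.length + 1 := by
  classical
  have : {z | z ∈ w.support} = (w.support.toFinset : Set V) := by ext; simp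
  rw [this, Set.ncard_coe_finset, List.toFinset_card_of_nodup hw.support_nodup,
    SimpleGraph.Walk.length_support]

/-! ### The simple path around a run in the top row. -/

namespace IsTopRun

variable {x : BoundaryConfig N} {s : ℤˣ} {a b : ℕ}

/-- The path that goes around a run in the top row. -/
theorem exists_isSimplePath_neg (h : IsTopRun x s a b) : ∃ E : Set (Site N),
    (∀ P, IsSimplePath x (-s) P ↔ P = E) ∧
      ∀ z ∈ interior N, z ∈ E ↔ (z.1 : ℕ) = 1 ∧ a ≤ (z.2 : ℕ) + 1 ∧ (z.2 : ℕ) ≤ b + 1 := by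
  have h₁ := h.one_le
  have h₂ := h.le
  have h₃ := h.le_N
  have ha₁ : ((site N 0 (a - 1)).1 : ℕ) = 0 := site_fst (by omega)
  have ha₂ : ((site N 0 (a - 1)).2 : ℕ) = a - 1 := site_snd (by omega)
  have hb₁ : ((site N 0 (b + 1)).1 : ℕ) = 0 := site_fst (by omega)
  have hb₂ : ((site N 0 (b + 1)).2 : ℕ) = b + 1 := site_snd (by omega)
  let A := interior N ∪ run x (-s)
  have hmemA : ∀ z : Site N, z ∈ A ↔ ¬ ((z.1 : ℕ) = 0 ∧ a ≤ (z.2 : ℕ) ∧ (z.2 : ℕ) ≤ b) := by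
    intro z
    have := z.fst_le
    have := z.snd_le
    simp only [A, Set.mem_union, h.mem_run_neg, mem_boundary_iff, mem_interior_iff]
    omega
  obtain ⟨w₁, hl₁, hs₁⟩ := exists_vertical_walk (N := N) (i := 0) (i' := 1) (j := a - 1)
    (by omega) (by omega) (by omega)
  obtain ⟨w₂, hl₂, hs₂⟩ := exists_horizontal_walk (N := N) (i := 1) (j := a - 1) (j' := b + 1)
    (by omega) (by omega) (by omega)
  obtain ⟨w₃, hl₃, hs₃⟩ := exists_vertical_walk (N := N) (i := 0) (i' := 1) (j := b + 1)
    (by omega) (by omega) (by omega)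
  let w₀ := (w₁.append w₂).append w₃.reverse
  have hl₀ : w₀.length = b + 4 - a := by
    simp only [w₀, SimpleGraph.Walk.length_append, SimpleGraph.Walk.length_reverse]
    omega
  have hs₀ : ∀ z, z ∈ w₀.support ↔ (((z.2 : ℕ) = a - 1 ∧ 0 ≤ (z.1 : ℕ) ∧ (z.1 : ℕ) ≤ 1) ∨
      ((z.1 : ℕ) = 1 ∧ a - 1 ≤ (z.2 : ℕ) ∧ (z.2 : ℕ) ≤ b + 1)) ∨
      ((z.2 : ℕ) = b + 1 ∧ 0 ≤ (z.1 : ℕ) ∧ (z.1 : ℕ) ≤ 1) := by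
    intro z
    simp only [w₀, SimpleGraph.Walk.mem_support_append_iff, SimpleGraph.Walk.support_reverse,
      List.mem_reverse, hs₁, hs₂, hs₃]
  -- Lower bounds for the distances from the two ends once the run is removed: the distance of the
  -- columns plus the number of the row, where the part of the top row on the far side of the run
  -- counts 2, for one step down and one step up.
  let f : Site N → ℕ := fun z => (if (z.2 : ℕ) < a then a - 1 - z.2 else z.2 + 1 - a) +
    (if (z.1 : ℕ) = 0 ∧ a ≤ (z.2 : ℕ) then 2 else (z.1 : ℕ))
  let g : Site N → ℕ := fun z => (if (z.2 : ℕ) ≤ b then b + 1 - z.2 else z.2 - (b + 1)) +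
    (if (z.1 : ℕ) = 0 ∧ (z.2 : ℕ) ≤ b then 2 else (z.1 : ℕ))
  have hf : ∀ z ∈ A, ∀ z' ∈ A, (grid N).Adj z z' → f z' ≤ f z + 1 := by
    intro z hz z' hz' ha
    rw [hmemA] at hz hz'
    rw [grid_adj_iff] at ha
    simp only [f]
    split_ifs <;> omega
  have hg : ∀ z ∈ A, ∀ z' ∈ A, (grid N).Adj z z' → g z' ≤ g z + 1 := by
    intro z hz z' hz' ha
    rw [hmemA] at hz hz'
    rw [grid_adj_iff] at ha
    simp only [g]
    split_ifs <;> omega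
  have hfu : f (site N 0 (a - 1)) = 0 := by
    simp only [f, ha₁, ha₂]
    split_ifs <;> omega
  have hgv : g (site N 0 (b + 1)) = 0 := by
    simp only [g, hb₁, hb₂]
    split_ifs <;> omega
  have hfv : f (site N 0 (b + 1)) = b + 4 - a := by
    simp only [f, hb₁, hb₂, true_and]
    split_ifs <;> omega
  have hA₀ : ∀ z ∈ w₀.support, z ∈ A := by
    intro z hz
    rw [hs₀] at hz
    rw [hmemA]
    omega
  have hmin : ∀ w : (grid N).Walk (site N 0 (a - 1)) (site N 0 (b + 1)),
      (∀ z ∈ w.support, z ∈ A) → w₀.length ≤ w.length := fun w hA => by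
    have := le_add_length_of_lipschitz hf w hA
    omega
  have hp₀ := isPath_of_length_minimal w₀ hA₀ hmin
  refine ⟨{z | z ∈ w₀.support}, fun P => ?_, ?_⟩
  · rw [isSimplePath_iff h.runEnds_neg_eq w₀ hA₀ hmin P]
    constructor
    · rintro ⟨w, hp, hA, hl, rfl⟩
      -- The bound on `f + g` forces every shortest path into the sites of `w₀`; both paths have
      -- equally many sites, so they agree.
      refine Set.eq_of_subset_of_ncard_le ?_ ?_ (Set.toFinite _)
      · intro z hz
        have hfg := add_le_length_of_lipschitz hf hg hfu hgv w hA hz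
        have hzA := (hmemA z).1 (hA z hz)
        rw [Set.mem_ofPred_eq, hs₀]
        rw [hl, hl₀] at hfg
        simp only [f, g] at hfg
        split_ifs at hfg <;> omega
      · rw [ncard_support_of_isPath hp₀, ncard_support_of_isPath hp, hl]
    · rintro rfl
      exact ⟨w₀, hp₀, hA₀, rfl, rfl⟩
  · intro z hz
    rw [mem_interior_iff] at hz
    rw [Set.mem_ofPred_eq, hs₀]
    omega

/-- The detour covers every interior site that is near the run, including diagonally at its two
ends. So it separates the run from the rest of the interior, and its closed region is the complement
of the run. -/
theorem pathsBoundCores_neg (h : IsTopRun x s a b) : PathsBoundCores x (-s) := by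
  obtain ⟨E, hE, hEint⟩ := h.exists_isSimplePath_neg
  have hEA : ∀ z ∈ E, z ∉ run x s := by
    intro z hz hzr
    obtain ⟨u, v, w, hJ, -, he⟩ := (hE E).2 rfl
    rcases hJ.2.2 z (by rw [he] at hz; exact hz) with h' | h'
    · exact run_subset_boundary hzr h'
    · exact (mem_run_neg_iff.1 h').2 hzr
  have hreg : closedRegion x (-s) E = (run x s)ᶜ := by
    apply Set.Subset.antisymm
    · intro w hw hwr
      refine notMem_closedRegion_of_up (fun z hz₁ hz₂ hz => ?_) hw
      have hzr : z ∈ run x s := by rw [h.mem_run] at hwr ⊢; omega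
      rcases hz with hz | hz
      · exact hEA z hz hzr
      · exact (mem_run_neg_iff.1 hz).2 hzr
    · refine subset_closedRegion ?_ ?_
      · intro w hw hwb
        exact Or.inr (mem_run_neg_iff.2 ⟨hwb, hw⟩)
      · intro v hv hvS w hvw hw
        have hvI : v ∈ interior N := by
          by_contra hvb
          exact hvS (Or.inr (mem_run_neg_iff.2 ⟨hvb, hv⟩))
        refine hvS (Or.inl ((hEint v hvI).2 ?_))
        obtain ⟨h₁, h₂, h₃, h₄⟩ := hvw
        rw [h.mem_run] at hw
        rw [mem_interior_iff] at hvI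
        omega
  refine pathsBoundCores_of ?_ ?_ ?_ ?_
  · intro P hP
    rw [(hE P).1 hP, hreg, neg_neg, h.core_eq, h.core_neg_eq]
    exact ⟨le_rfl, le_rfl⟩
  · intro P Q hP hQ _
    rw [(hE P).1 hP, (hE Q).1 hQ]
  · exact ⟨E, (hE _).2 rfl, by rw [hreg, h.core_neg_eq]⟩
  · exact ⟨E, (hE _).2 rfl, by rw [hreg, neg_neg, h.core_eq]⟩

end IsTopRun

/-! ### The cyclic order of the boundary -/

/-- The position of a boundary site on the boundary cycle, counted clockwise from the upper left
corner. -/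
def pos (v : Site N) : ℕ :=
  if (v.1 : ℕ) = 0 then v.2 else if (v.2 : ℕ) = N + 1 then N + 1 + v.1
  else if (v.1 : ℕ) = N + 1 then 3 * (N + 1) - v.2 else 4 * (N + 1) - v.1

theorem pos_lt (v : Site N) : pos v < 4 * N + 4 := by
  have := v.fst_le
  have := v.snd_le
  unfold pos
  split_ifs <;> omega

theorem pos_injOn {v w : Site N} (hv : v ∈ boundary N) (hw : w ∈ boundary N)
    (h : pos v = pos w) : v = w := by
  rw [mem_boundary_iff] at hv hw
  have := v.fst_le
  have := v.snd_le
  have := w.fst_le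
  have := w.snd_le
  unfold pos at h
  refine Site.ext_nat ?_ ?_ <;> split_ifs at h <;> omega

theorem pos_adj {v w : Site N} (hv : v ∈ boundary N) (hw : w ∈ boundary N)
    (h : (grid N).Adj v w) : pos w = pos v + 1 ∨ pos v = pos w + 1 ∨
      (pos v = 0 ∧ pos w = 4 * N + 3) ∨ (pos w = 0 ∧ pos v = 4 * N + 3) := by
  rw [mem_boundary_iff] at hv hw
  rw [grid_adj_iff] at h
  have := v.fst_le
  have := v.snd_le
  have := w.fst_le
  have := w.snd_le
  unfold pos
  split_ifs <;> omega

/-- A walk within `R^+` moves the position by one at a time. Starting strictly between `b` and `d`,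
it cannot pass these negative sites, nor can it reach the jump of `pos` at the upper left corner. -/
theorem run_one_between {x : BoundaryConfig N} (hx : IsOneRun x) {a b c d : Site N}
    (ha : a ∈ run x 1) (hc : c ∈ run x 1) (hb : b ∈ run x (-1)) (hd : d ∈ run x (-1))
    (hba : pos b < pos a) (had : pos a < pos d) : pos b < pos c ∧ pos c < pos d := by
  have hne : ∀ y ∈ run x 1, ∀ z ∈ run x (-1), pos y ≠ pos z := fun y hy z hz h =>
    (mem_run_neg_iff.1 hz).2 (pos_injOn hy.1 hz.1 h ▸ hy)
  obtain ⟨w⟩ := hx.1.preconnected ⟨a, ha⟩ ⟨c, hc⟩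
  have key : ∀ (y z : run x 1) (w : ((grid N).induce (run x 1)).Walk y z),
      pos b < pos (y : Site N) → pos (y : Site N) < pos d →
        pos b < pos (z : Site N) ∧ pos (z : Site N) < pos d := by
    intro y z w
    induction w with
    | nil => exact fun h₁ h₂ => ⟨h₁, h₂⟩
    | @cons y y' z h w ih =>
      intro h₁ h₂
      have h₃ := pos_adj y.2.1 y'.2.1 h
      have h₄ := hne y' y'.2 b hb
      have h₅ := hne y' y'.2 d hd
      have h₆ := pos_lt d
      exact ih (by omega) (by omega)
  exact key _ _ w hba had

/-- Sites of opposite signs do not alternate along the boundary cycle. -/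
theorem run_between {x : BoundaryConfig N} (hx : IsOneRun x) {s : ℤˣ} {a b c d : Site N}
    (ha : a ∈ run x s) (hc : c ∈ run x s) (hb : b ∈ run x (-s)) (hd : d ∈ run x (-s))
    (hba : pos b < pos a) (had : pos a < pos d) : pos b < pos c ∧ pos c < pos d := by
  rcases Int.units_eq_one_or s with rfl | rfl
  · exact run_one_between hx ha hc hb hd hba had
  · rw [neg_neg] at hb hd
    have hne : ∀ y ∈ run x 1, ∀ z ∈ run x (-1), pos y ≠ pos z := fun y hy z hz h =>
      (mem_run_neg_iff.1 hz).2 (pos_injOn hy.1 hz.1 h ▸ hy)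
    have h₁ := hne b hb c hc
    have h₂ := hne d hd c hc
    -- Otherwise one of the positive sites `b`, `d` lies between the negative sites `a` and `c`
    -- while the other does not, against the positive case.
    by_contra hcon
    rcases Nat.lt_or_ge (pos c) (pos b) with h | h
    · have := run_one_between hx hb hd hc ha h hba
      omega
    · have := run_one_between hx hd hb ha hc had (by omega)
      omega

theorem run_nonempty {x : BoundaryConfig N} (hx : IsOneRun x) (s : ℤˣ) : (run x s).Nonempty := by
  rcases Int.units_eq_one_or s with rfl | rfl
  · obtain ⟨v⟩ := hx.1.nonempty
    exact ⟨v, v.2⟩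
  · exact hx.2

/-! ### Symmetries of the grid -/

/-- The involutive symmetries of the grid. -/
structure IsReflection (e : Site N → Site N) : Prop where
  invol : ∀ v, e (e v) = v
  adj : ∀ v w, (grid N).Adj v w → (grid N).Adj (e v) (e w)
  near : ∀ v w, Near v w → Near (e v) (e w)
  mem_interior : ∀ v ∈ interior N, e v ∈ interior N
  mem_core : ∀ x x' : BoundaryConfig N, (∀ s v, v ∈ run x' s ↔ e v ∈ run x s) →
    ∀ s v, v ∈ core x' s → e v ∈ core x s

namespace IsReflection

variable {e : Site N → Site N}

theorem mem_interior_iff (he : IsReflection e) (v : Site N) :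
    e v ∈ interior N ↔ v ∈ interior N :=
  ⟨fun h => he.invol v ▸ he.mem_interior _ h, he.mem_interior v⟩

theorem mem_boundary_iff (he : IsReflection e) (v : Site N) :
    e v ∈ boundary N ↔ v ∈ boundary N :=
  not_congr (he.mem_interior_iff v)

theorem adj_iff (he : IsReflection e) (v w : Site N) :
    (grid N).Adj (e v) (e w) ↔ (grid N).Adj v w :=
  ⟨fun h => by simpa only [he.invol] using he.adj _ _ h, he.adj v w⟩

theorem injective (he : IsReflection e) : Function.Injective e :=
  Function.Involutive.injective he.invol

theorem preimage_preimage (he : IsReflection e) (S : Set (Site N)) : e ⁻¹' (e ⁻¹' S) = S := by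
  ext v
  simp only [Set.mem_preimage, he.invol]

theorem image_eq_preimage (he : IsReflection e) (S : Set (Site N)) : e '' S = e ⁻¹' S :=
  congrFun (Set.image_eq_preimage_of_inverse he.invol he.invol) S

theorem ncard_preimage (he : IsReflection e) (S : Set (Site N)) :
    (e ⁻¹' S).ncard = S.ncard := by
  rw [← he.image_eq_preimage, Set.ncard_image_of_injective _ he.injective]

/-- A reflection as a graph homomorphism. -/
def hom (he : IsReflection e) : grid N →g grid N := ⟨e, fun h => he.adj _ _ h⟩

end IsReflection

/-- The configurations `x` and `x'` correspond to each other under the reflection `e`. -/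
structure Reflects (e : Site N → Site N) (x x' : BoundaryConfig N) : Prop where
  isReflection : IsReflection e
  mem_run : ∀ s v, v ∈ run x' s ↔ e v ∈ run x s

theorem IsReflection.exists_reflects {e : Site N → Site N} (he : IsReflection e)
    (x : BoundaryConfig N) : ∃ x', Reflects e x x' := by
  refine ⟨fun v => x ⟨e v, (he.mem_boundary_iff v).2 v.2⟩, he, fun s v => ?_⟩
  exact ⟨fun ⟨h, hs⟩ => ⟨(he.mem_boundary_iff v).2 h, hs⟩,
    fun ⟨h, hs⟩ => ⟨(he.mem_boundary_iff v).1 h, hs⟩⟩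

namespace Reflects

variable {e : Site N → Site N} {x x' : BoundaryConfig N}

theorem symm (h : Reflects e x x') : Reflects e x' x :=
  ⟨h.isReflection, fun s v => by rw [h.mem_run, h.isReflection.invol]⟩

theorem isOneRun (h : Reflects e x x') (hx : IsOneRun x) : IsOneRun x' := by
  have he := h.isReflection
  let f : (grid N).induce (run x' 1) ≃g (grid N).induce (run x 1) :=
    { toFun := fun v => ⟨e v, (h.mem_run 1 v).1 v.2⟩
      invFun := fun v => ⟨e v, (h.symm.mem_run 1 v).1 v.2⟩
      left_inv := fun v => Subtype.ext (he.invol v)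
      right_inv := fun v => Subtype.ext (he.invol v)
      map_rel_iff' := fun {v w} => he.adj_iff v w }
  refine ⟨f.connected_iff.2 hx.1, ?_⟩
  obtain ⟨v, hv⟩ := hx.2
  exact ⟨e v, (h.symm.mem_run _ v).1 hv⟩

theorem mem_core_iff (h : Reflects e x x') (s : ℤˣ) (v : Site N) :
    v ∈ core x' s ↔ e v ∈ core x s :=
  ⟨h.isReflection.mem_core x x' h.mem_run s v, fun hv => by
    have := h.isReflection.mem_core x' x h.symm.mem_run s _ hv
    rwa [h.isReflection.invol] at this⟩

theorem runEnds_eq (h : Reflects e x x') (s : ℤˣ) : runEnds x' s = e ⁻¹' runEnds x s := by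
  have he := h.isReflection
  ext v
  have : (grid N).neighborSet v ∩ run x' s = e ⁻¹' ((grid N).neighborSet (e v) ∩ run x s) := by
    ext w
    simp only [Set.mem_inter_iff, Set.mem_preimage, SimpleGraph.mem_neighborSet, he.adj_iff,
      h.mem_run]
  simp only [runEnds, Set.mem_ofPred_eq, Set.mem_preimage, h.mem_run, this, he.ncard_preimage]

theorem joinsEnds (h : Reflects e x x') {s : ℤˣ} {u v : Site N} {w : (grid N).Walk u v}
    (hw : JoinsEnds x' s w) : JoinsEnds x s (w.map h.isReflection.hom) := by
  have he := h.isReflection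
  obtain ⟨h₁, h₂, h₃⟩ := hw
  refine ⟨SimpleGraph.Walk.IsPath.map he.injective h₁, ?_, ?_⟩
  · rw [h.symm.runEnds_eq, h₂, ← he.image_eq_preimage, Set.image_pair]
    rfl
  · intro z hz
    rw [SimpleGraph.Walk.support_map, List.mem_map] at hz
    obtain ⟨y, hy, rfl⟩ := hz
    exact (h₃ y hy).imp (he.mem_interior y) (h.mem_run s y).1

theorem isSimplePath (h : Reflects e x x') {s : ℤˣ} {P : Set (Site N)}
    (hP : IsSimplePath x' s P) : IsSimplePath x s (e ⁻¹' P) := by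
  obtain ⟨u, v, w, hJ, hm, rfl⟩ := hP
  refine ⟨_, _, _, h.joinsEnds hJ, ?_, ?_⟩
  · intro u' v' w' hJ'
    have := hm _ _ _ (h.symm.joinsEnds hJ')
    rw [SimpleGraph.Walk.length_map] at this ⊢
    exact this
  · rw [← h.isReflection.image_eq_preimage]
    ext z
    simp only [Set.mem_image, Set.mem_ofPred_eq, SimpleGraph.Walk.support_map, List.mem_map]
    rfl

theorem closedRegion_subset (h : Reflects e x x') (s : ℤˣ) (P : Set (Site N)) :
    e ⁻¹' closedRegion x' s P ⊆ closedRegion x s (e ⁻¹' P) := by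
  have he := h.isReflection
  have hS : ∀ z, z ∈ (e ⁻¹' P) ∪ run x s ↔ e z ∈ P ∪ run x' s := fun z => by
    simp only [Set.mem_union, Set.mem_preimage, h.symm.mem_run]
  intro v hv
  by_contra hcon
  obtain ⟨hvS, u, hu, huS, hgen⟩ := mem_closedRegion_compl.1 hcon
  refine mem_closedRegion_compl.2 ⟨?_, e u, (he.mem_boundary_iff u).2 hu, ?_, ?_⟩ hv
  · rwa [hS] at hvS
  · rwa [hS] at huS
  · refine hgen.lift e fun a b hab => ⟨he.near _ _ hab.1, ?_⟩
    rw [← hS]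
    exact hab.2

theorem closedRegion_eq (h : Reflects e x x') (s : ℤˣ) (P : Set (Site N)) :
    closedRegion x s (e ⁻¹' P) = e ⁻¹' closedRegion x' s P := by
  refine Set.Subset.antisymm ?_ (h.closedRegion_subset s P)
  have := h.symm.closedRegion_subset s (e ⁻¹' P)
  rw [h.isReflection.preimage_preimage] at this
  intro v hv
  refine this ?_
  rwa [Set.mem_preimage, h.isReflection.invol]

theorem isInnerPath (h : Reflects e x x') {s : ℤˣ} {P : Set (Site N)}
    (hP : IsInnerPath x' s P) : IsInnerPath x s (e ⁻¹' P) := by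
  refine ⟨h.isSimplePath hP.1, fun Q hQ => ?_⟩
  have := hP.2 _ (h.symm.isSimplePath hQ)
  rwa [h.symm.closedRegion_eq, h.isReflection.ncard_preimage,
    ← h.isReflection.ncard_preimage (closedRegion x' s P), ← h.closedRegion_eq] at this

theorem isOuterPath (h : Reflects e x x') {s : ℤˣ} {P : Set (Site N)}
    (hP : IsOuterPath x' s P) : IsOuterPath x s (e ⁻¹' P) := by
  refine ⟨h.isSimplePath hP.1, fun Q hQ => ?_⟩
  have := hP.2 _ (h.symm.isSimplePath hQ)
  rwa [h.symm.closedRegion_eq, h.isReflection.ncard_preimage,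
    ← h.isReflection.ncard_preimage (closedRegion x' s P), ← h.closedRegion_eq] at this

theorem innerSet_eq (h : Reflects e x x') (s : ℤˣ) : innerSet x s = e ⁻¹' innerSet x' s := by
  ext v
  constructor
  · rintro ⟨P, hP, hv⟩
    refine ⟨e ⁻¹' P, h.symm.isInnerPath hP, ?_⟩
    rwa [h.symm.closedRegion_eq, Set.mem_preimage, h.isReflection.invol]
  · rintro ⟨P, hP, hv⟩
    refine ⟨e ⁻¹' P, h.isInnerPath hP, ?_⟩
    rwa [h.closedRegion_eq]

theorem outerSet_eq (h : Reflects e x x') (s : ℤˣ) : outerSet x s = e ⁻¹' outerSet x' s := by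
  ext v
  constructor
  · rintro ⟨P, hP, hv⟩
    refine ⟨e ⁻¹' P, h.symm.isOuterPath hP, ?_⟩
    rwa [h.symm.closedRegion_eq, Set.mem_preimage, h.isReflection.invol]
  · rintro ⟨P, hP, hv⟩
    refine ⟨e ⁻¹' P, h.isOuterPath hP, ?_⟩
    rwa [h.closedRegion_eq]

theorem pathsBoundCores (h : Reflects e x x') {s : ℤˣ} (hx' : PathsBoundCores x' s) :
    PathsBoundCores x s := by
  obtain ⟨⟨P, hP, hPu⟩, ⟨Q, hQ, hQu⟩, hI, hO⟩ := hx'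
  refine ⟨⟨e ⁻¹' P, h.isInnerPath hP, ?_⟩, ⟨e ⁻¹' Q, h.isOuterPath hQ, ?_⟩, ?_, ?_⟩
  · intro P' hP'
    rw [← hPu _ (h.symm.isInnerPath hP'), h.isReflection.preimage_preimage]
  · intro P' hP'
    rw [← hQu _ (h.symm.isOuterPath hP'), h.isReflection.preimage_preimage]
  · rw [h.innerSet_eq, hI]
    ext v
    exact (h.symm.mem_core_iff s v).symm
  · rw [h.outerSet_eq, hO]
    ext v
    exact not_congr (h.symm.mem_core_iff (-s) v).symm

end Reflects

/-! #### The reflections that are used -/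

/-- The reflection that exchanges the top and the bottom side. -/
def flipRows (v : Site N) : Site N := site N (N + 1 - v.1) v.2

/-- The reflection that exchanges the left and the right side. -/
def flipCols (v : Site N) : Site N := site N v.1 (N + 1 - v.2)

/-- The reflection that exchanges rows and columns. -/
def transpose (v : Site N) : Site N := (v.2, v.1)

theorem flipRows_fst (v : Site N) : ((flipRows v).1 : ℕ) = N + 1 - v.1 := site_fst (by omega)

theorem flipRows_snd (v : Site N) : ((flipRows v).2 : ℕ) = v.2 := site_snd v.snd_le

theorem flipCols_fst (v : Site N) : ((flipCols v).1 : ℕ) = v.1 := site_fst v.fst_le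

theorem flipCols_snd (v : Site N) : ((flipCols v).2 : ℕ) = N + 1 - v.2 := site_snd (by omega)

theorem flipRows_site {i j : ℕ} (hi : i ≤ N + 1) (hj : j ≤ N + 1) :
    flipRows (site N i j) = site N (N + 1 - i) j := by
  rw [flipRows, site_fst hi, site_snd hj]

theorem flipCols_site {i j : ℕ} (hi : i ≤ N + 1) (hj : j ≤ N + 1) :
    flipCols (site N i j) = site N i (N + 1 - j) := by
  rw [flipCols, site_fst hi, site_snd hj]

theorem transpose_site (i j : ℕ) : transpose (site N i j) = site N j i := rfl

theorem isReflection_flipRows : IsReflection (flipRows (N := N)) where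
  invol v := by
    have := v.fst_le
    refine Site.ext_nat ?_ ?_ <;> simp only [flipRows_fst, flipRows_snd]
    omega
  adj v w := by
    have := v.fst_le
    have := w.fst_le
    rw [grid_adj_iff, grid_adj_iff, flipRows_fst, flipRows_fst, flipRows_snd, flipRows_snd]
    omega
  near v w := by
    have := v.fst_le
    have := w.fst_le
    simp only [Near, flipRows_fst, flipRows_snd]
    omega
  mem_interior v := by
    simp only [GridInterp.mem_interior_iff, flipRows_fst, flipRows_snd]
    omega
  mem_core x x' h s v := by
    have h₁ := v.fst_le
    have h₂ := v.snd_le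
    simp only [core, Set.mem_ofPred_eq, h, flipRows_site h₁ (Nat.zero_le _),
      flipRows_site h₁ le_rfl, flipRows_site (Nat.zero_le _) h₂, flipRows_site le_rfl h₂,
      GridInterp.mem_interior_iff, flipRows_fst, flipRows_snd, Nat.sub_zero, Nat.sub_self]
    rintro (h | ⟨h, h'⟩)
    · exact Or.inl h
    · exact Or.inr ⟨by omega, h'.imp id And.symm⟩

theorem isReflection_flipCols : IsReflection (flipCols (N := N)) where
  invol v := by
    have := v.snd_le
    refine Site.ext_nat ?_ ?_ <;> simp only [flipCols_fst, flipCols_snd]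
    omega
  adj v w := by
    have := v.snd_le
    have := w.snd_le
    rw [grid_adj_iff, grid_adj_iff, flipCols_fst, flipCols_fst, flipCols_snd, flipCols_snd]
    omega
  near v w := by
    have := v.snd_le
    have := w.snd_le
    simp only [Near, flipCols_fst, flipCols_snd]
    omega
  mem_interior v := by
    simp only [GridInterp.mem_interior_iff, flipCols_fst, flipCols_snd]
    omega
  mem_core x x' h s v := by
    have h₁ := v.fst_le
    have h₂ := v.snd_le
    simp only [core, Set.mem_ofPred_eq, h, flipCols_site h₁ (Nat.zero_le _),
      flipCols_site h₁ le_rfl, flipCols_site (Nat.zero_le _) h₂, flipCols_site le_rfl h₂,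
      GridInterp.mem_interior_iff, flipCols_fst, flipCols_snd, Nat.sub_zero, Nat.sub_self]
    rintro (h | ⟨h, h'⟩)
    · exact Or.inl h
    · exact Or.inr ⟨by omega, h'.imp And.symm id⟩

theorem isReflection_transpose : IsReflection (transpose (N := N)) where
  invol v := rfl
  adj v w := by
    rw [grid_adj_iff, grid_adj_iff]
    exact Or.symm
  near v w := by
    simp only [Near, transpose]
    omega
  mem_interior v := by
    simp only [GridInterp.mem_interior_iff, transpose]
    omega
  mem_core x x' h s v := by
    simp only [core, Set.mem_ofPred_eq, h, transpose_site, GridInterp.mem_interior_iff]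
    rintro (h | ⟨h, h'⟩)
    · exact Or.inl h
    · refine Or.inr ⟨?_, h'.symm⟩
      simp only [transpose]
      omega

/-! ### Normal forms of one-run configurations -/

/-- The sites of the left and the top side, from the lower left to the upper right corner. -/
def leftTop (N k : ℕ) : Site N := site N (N + 1 - k) (k - (N + 1))

/-- The sites of the bottom and the right side, from the lower left to the upper right corner. -/
def bottomRight (N k : ℕ) : Site N := site N (2 * (N + 1) - max k (N + 1)) (min k (N + 1))

/-- An initial segment of the natural numbers that is proper below `m` has a last element. -/
theorem exists_last {p : ℕ → Prop} {m : ℕ} (h₀ : p 0) (hm : ¬ p m)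
    (hp : ∀ k k', k < k' → k' ≤ m → p k' → p k) :
    ∃ l < m, ∀ k ≤ m, p k ↔ k ≤ l := by
  classical
  have hex : ∃ k, ¬ p k := ⟨m, hm⟩
  have hspec := Nat.find_spec hex
  have hle := Nat.find_min' hex hm
  have hpos : Nat.find hex ≠ 0 := fun h => by rw [h] at hspec; exact hspec h₀
  refine ⟨Nat.find hex - 1, by omega, fun k hk => ⟨fun hpk => ?_, fun hkl => ?_⟩⟩
  · by_contra hlt
    rcases Nat.lt_or_ge (Nat.find hex) k with h | h
    · exact hspec (hp _ k h hk hpk)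
    · have : k = Nat.find hex := by omega
      exact hspec (this ▸ hpk)
  · exact not_not.1 (Nat.find_min hex (show k < Nat.find hex by omega))

/-! ### Runs that contain exactly one of two opposite corners. -/

section Staircase

variable {x : BoundaryConfig N} {s : ℤˣ}

/-- If the sign returned to `s` on the way from the lower left to the upper right corner, the two
sites of this side and the two corners would alternate in sign around the cycle. -/
theorem exists_last_leftTop (hx : IsOneRun x) (hBL : site N (N + 1) 0 ∈ run x s)
    (hTR : site N 0 (N + 1) ∈ run x (-s)) :
    ∃ l < 2 * (N + 1), ∀ k ≤ 2 * (N + 1), leftTop N k ∈ run x s ↔ k ≤ l := by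
  have h0 : leftTop N 0 = site N (N + 1) 0 := by simp [leftTop]
  have hm : leftTop N (2 * (N + 1)) = site N 0 (N + 1) := by
    unfold leftTop; congr 1 <;> omega
  refine exists_last (h0 ▸ hBL) (fun h => (mem_run_neg_iff.1 hTR).2 (hm ▸ h)) ?_
  intro k k' hkk' hk' hmem
  by_contra hk
  have hneg : leftTop N k ∈ run x (-s) := by
    refine mem_run_neg_iff.2 ⟨?_, hk⟩
    rw [mem_boundary_iff, leftTop, site_fst (by omega), site_snd (by omega)]
    omega
  have hlt : k' < 2 * (N + 1) := by
    refine lt_of_le_of_ne hk' fun h => (mem_run_neg_iff.1 hTR).2 ?_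
    rw [← hm, ← h]
    exact hmem
  -- Positions start again from 0 at the upper left corner, where `k = N + 1`; hence the later case
  -- distinction on `k`.
  have hpos : ∀ k < 2 * (N + 1), pos (leftTop N k) =
      if k < N + 1 then 3 * (N + 1) + k else k - (N + 1) := by
    intro k hk
    rw [pos, leftTop, site_fst (by omega), site_snd (by omega)]
    split_ifs <;> omega
  have p₁ := hpos k (by omega)
  have p₂ := hpos k' hlt
  have p₃ : pos (site N (N + 1) 0) = 3 * (N + 1) := by
    rw [← h0, hpos 0 (by omega), if_pos (by omega)]; omega
  have p₄ : pos (site N 0 (N + 1)) = N + 1 := by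
    rw [pos, site_fst (by omega), site_snd (by omega), if_pos rfl]
  rcases Nat.lt_or_ge k (N + 1) with h | h
  · rw [if_pos h] at p₁
    have hk0 : k ≠ 0 := fun hk0 => hk (by rw [hk0, h0]; exact hBL)
    have := run_between hx hBL hmem hTR hneg (by omega) (by omega)
    split_ifs at p₂ <;> omega
  · rw [if_neg (by omega)] at p₁ p₂
    have := run_between hx hmem hBL hneg hTR (by omega) (by omega)
    omega

theorem exists_last_bottomRight (hx : IsOneRun x) (hBL : site N (N + 1) 0 ∈ run x s)
    (hTR : site N 0 (N + 1) ∈ run x (-s)) :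
    ∃ l < 2 * (N + 1), ∀ k ≤ 2 * (N + 1), bottomRight N k ∈ run x s ↔ k ≤ l := by
  have h0 : bottomRight N 0 = site N (N + 1) 0 := by
    unfold bottomRight; congr 1; omega
  have hm : bottomRight N (2 * (N + 1)) = site N 0 (N + 1) := by
    unfold bottomRight; congr 1 <;> omega
  refine exists_last (h0 ▸ hBL) (fun h => (mem_run_neg_iff.1 hTR).2 (hm ▸ h)) ?_
  intro k k' hkk' hk' hmem
  by_contra hk
  have hneg : bottomRight N k ∈ run x (-s) := by
    refine mem_run_neg_iff.2 ⟨?_, hk⟩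
    rw [mem_boundary_iff, bottomRight, site_fst (by omega), site_snd (by omega)]
    omega
  have hlt : k' < 2 * (N + 1) := by
    refine lt_of_le_of_ne hk' fun h => (mem_run_neg_iff.1 hTR).2 ?_
    rw [← hm, ← h]
    exact hmem
  have hpos : ∀ k < 2 * (N + 1), pos (bottomRight N k) = 3 * (N + 1) - k := by
    intro k hk
    rw [pos, bottomRight, site_fst (by omega), site_snd (by omega)]
    split_ifs <;> omega
  have p₁ := hpos k (by omega)
  have p₂ := hpos k' hlt
  have p₃ : pos (site N (N + 1) 0) = 3 * (N + 1) := by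
    rw [← h0, hpos 0 (by omega)]; omega
  have p₄ : pos (site N 0 (N + 1)) = N + 1 := by
    rw [pos, site_fst (by omega), site_snd (by omega), if_pos rfl]
  have := run_between hx hmem hBL hTR hneg (by omega) (by omega)
  omega

theorem pathsBoundCores_of_corners (hx : IsOneRun x) (hBL : site N (N + 1) 0 ∈ run x s)
    (hTR : site N 0 (N + 1) ∈ run x (-s)) : PathsBoundCores x s := by
  obtain ⟨l, hl, hlr⟩ := exists_last_leftTop hx hBL hTR
  obtain ⟨m, hm, hmr⟩ := exists_last_bottomRight hx hBL hTR
  have hrun : ∀ w : Site N, w ∈ run x s ↔ ((w.2 : ℕ) = 0 ∧ N + 1 ≤ w.1 + l) ∨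
      ((w.1 : ℕ) = 0 ∧ N + 1 + w.2 ≤ l) ∨ ((w.1 : ℕ) = N + 1 ∧ (w.2 : ℕ) ≤ m) ∨
      ((w.2 : ℕ) = N + 1 ∧ 2 * (N + 1) ≤ m + w.1) := by
    intro w
    have h₁ := w.fst_le
    have h₂ := w.snd_le
    have hL : ∀ k ≤ 2 * (N + 1), (w.1 : ℕ) = N + 1 - k → (w.2 : ℕ) = k - (N + 1) →
        (w ∈ run x s ↔ k ≤ l) := fun k hk e₁ e₂ => by
      rw [← hlr k hk, leftTop, ← eq_site e₁ e₂]
    have hR : ∀ k ≤ 2 * (N + 1), (w.1 : ℕ) = 2 * (N + 1) - max k (N + 1) →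
        (w.2 : ℕ) = min k (N + 1) → (w ∈ run x s ↔ k ≤ m) := fun k hk e₁ e₂ => by
      rw [← hmr k hk, bottomRight, ← eq_site e₁ e₂]
    by_cases hb : w ∈ boundary N
    · rw [mem_boundary_iff] at hb
      have e₁ := hL (N + 1 - w.1) (by omega)
      have e₂ := hL (N + 1 + w.2) (by omega)
      have e₃ := hR w.2 (by omega)
      have e₄ := hR (2 * (N + 1) - w.1) (by omega)
      by_cases hw : w ∈ run x s
      · simp only [hw, true_iff] at e₁ e₂ e₃ e₄ ⊢
        omega
      · simp only [hw, false_iff] at e₁ e₂ e₃ e₄ ⊢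
        omega
    · rw [mem_boundary_iff] at hb
      constructor
      · intro hw
        exact absurd (mem_boundary_iff.1 hw.1) hb
      · omega
  -- The ends are `leftTop N l` and `bottomRight N m`. If the second lies in a higher row,
  -- exchanging left and right puts them in order; if it lies in a column further left, exchanging
  -- top and bottom does. Otherwise they already are in order.
  rcases Nat.lt_or_ge (2 * (N + 1) - max m (N + 1)) (N + 1 - l) with h₁ | h₁
  · obtain ⟨x', hx'⟩ := isReflection_flipCols.exists_reflects x
    refine hx'.pathsBoundCores (IsStaircaseRun.pathsBoundCores
      (u := site N (2 * (N + 1) - m) 0) (v := site N (N + 1 - l) (N + 1)) ?_)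
    have e₁ : ((site N (2 * (N + 1) - m) 0).1 : ℕ) = 2 * (N + 1) - m := site_fst (by omega)
    have e₂ : ((site N (2 * (N + 1) - m) 0).2 : ℕ) = 0 := site_snd (by omega)
    have e₃ : ((site N (N + 1 - l) (N + 1)).1 : ℕ) = N + 1 - l := site_fst (by omega)
    have e₄ : ((site N (N + 1 - l) (N + 1)).2 : ℕ) = N + 1 := site_snd (by omega)
    refine ⟨by omega, by omega, by omega, by omega, by omega, by omega, fun w => ?_⟩
    have := w.fst_le
    have := w.snd_le
    rw [hx'.mem_run, hrun, flipCols_fst, flipCols_snd, mem_boundary_iff]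
    omega
  rcases Nat.lt_or_ge (min m (N + 1)) (l - (N + 1)) with h₂ | h₂
  · obtain ⟨x', hx'⟩ := isReflection_flipRows.exists_reflects x
    refine hx'.pathsBoundCores (IsStaircaseRun.pathsBoundCores
      (u := site N 0 m) (v := site N (N + 1) (l - (N + 1))) ?_)
    have e₁ : ((site N 0 m).1 : ℕ) = 0 := site_fst (by omega)
    have e₂ : ((site N 0 m).2 : ℕ) = m := site_snd (by omega)
    have e₃ : ((site N (N + 1) (l - (N + 1))).1 : ℕ) = N + 1 := site_fst (by omega)
    have e₄ : ((site N (N + 1) (l - (N + 1))).2 : ℕ) = l - (N + 1) := site_snd (by omega)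
    refine ⟨by omega, by omega, by omega, by omega, by omega, by omega, fun w => ?_⟩
    have := w.fst_le
    have := w.snd_le
    rw [hx'.mem_run, hrun, flipRows_fst, flipRows_snd, mem_boundary_iff]
    omega
  · refine IsStaircaseRun.pathsBoundCores (u := leftTop N l) (v := bottomRight N m) ?_
    have e₁ : ((leftTop N l).1 : ℕ) = N + 1 - l := site_fst (by omega)
    have e₂ : ((leftTop N l).2 : ℕ) = l - (N + 1) := site_snd (by omega)
    have e₃ : ((bottomRight N m).1 : ℕ) = 2 * (N + 1) - max m (N + 1) := site_fst (by omega)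
    have e₄ : ((bottomRight N m).2 : ℕ) = min m (N + 1) := site_snd (by omega)
    refine ⟨by omega, by omega, by omega, by omega, by omega, by omega, fun w => ?_⟩
    have := w.fst_le
    have := w.snd_le
    rw [hrun, mem_boundary_iff]
    omega

end Staircase

/-! ### Runs inside one side, and the case distinction on the corners. -/

section TopRun

variable {x : BoundaryConfig N} {s : ℤˣ}

/-- One site of `R^s` in the top row lies between two corners of sign `-s`, which traps the whole
run between them. The first and last columns of the run serve as `a` and `b`, and a gap would again
give alternating signs. -/
theorem exists_isTopRun (hx : IsOneRun x) (hTL : site N 0 0 ∈ run x (-s))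
    (hTR : site N 0 (N + 1) ∈ run x (-s)) {w₀ : Site N} (hw₀ : w₀ ∈ run x s)
    (hw₀' : (w₀.1 : ℕ) = 0) : ∃ a b, IsTopRun x s a b := by
  classical
  have hne : ∀ w ∈ run x s, ∀ z ∈ run x (-s), w ≠ z := fun w hw z hz h =>
    (mem_run_neg_iff.1 hz).2 (h ▸ hw)
  have hpos : ∀ j ≤ N + 1, pos (site N 0 j) = j := fun j hj => by
    rw [pos, site_fst (by omega), site_snd hj, if_pos rfl]
  have p₁ := hpos 0 (by omega)
  have p₂ := hpos (N + 1) le_rfl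
  have htop : ∀ w ∈ run x s, (w.1 : ℕ) = 0 → 1 ≤ (w.2 : ℕ) ∧ (w.2 : ℕ) ≤ N := by
    intro w hw h
    have h₁ := w.snd_le
    have h₂ : (w.2 : ℕ) ≠ 0 := fun h' => hne w hw _ hTL (eq_site h h')
    have h₃ : (w.2 : ℕ) ≠ N + 1 := fun h' => hne w hw _ hTR (eq_site h h')
    omega
  have hw₀e : w₀ = site N 0 w₀.2 := eq_site hw₀' rfl
  have hb₀ := htop w₀ hw₀ hw₀'
  have p₃ := hpos w₀.2 (by omega)
  rw [← hw₀e] at p₃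
  have hrow : ∀ w ∈ run x s, (w.1 : ℕ) = 0 := by
    intro w hw
    have h := run_between hx hw₀ hw hTL hTR (by omega) (by omega)
    rw [p₁, p₂] at h
    have := w.fst_le
    have := w.snd_le
    have hb := mem_boundary_iff.1 hw.1
    unfold pos at h
    split_ifs at h <;> omega
  let S := (Finset.range (N + 2)).filter fun j => site N 0 j ∈ run x s
  have hS : ∀ j, j ∈ S ↔ j < N + 2 ∧ site N 0 j ∈ run x s := fun j => by simp [S]
  have hSne : S.Nonempty := ⟨w₀.2, (hS _).2 ⟨by omega, hw₀e ▸ hw₀⟩⟩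
  have hmin := (hS _).1 (S.min'_mem hSne)
  have hmax := (hS _).1 (S.max'_mem hSne)
  have hmm := S.min'_le _ (S.max'_mem hSne)
  have hmin' := htop _ hmin.2 (site_fst (by omega))
  have hmax' := htop _ hmax.2 (site_fst (by omega))
  rw [site_snd (by omega)] at hmin' hmax'
  refine ⟨S.min' hSne, S.max' hSne, hmin'.1, hmm, hmax'.2, fun w => ⟨fun hw => ?_, ?_⟩⟩
  · have h0 := hrow w hw
    have hwS : (w.2 : ℕ) ∈ S := (hS _).2 ⟨by have := w.snd_le; omega, eq_site h0 rfl ▸ hw⟩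
    exact ⟨h0, S.min'_le _ hwS, S.le_max' _ hwS⟩
  · rintro ⟨h0, h₁, h₂⟩
    by_contra hw
    have hwn : w ∈ run x (-s) := mem_run_neg_iff.2 ⟨mem_boundary_iff.2 (Or.inl h0), hw⟩
    have h₃ : (w.2 : ℕ) ≠ S.min' hSne := fun h => hne _ hmin.2 _ hwn (eq_site h0 h).symm
    have h₄ : (w.2 : ℕ) ≠ S.max' hSne := fun h => hne _ hmax.2 _ hwn (eq_site h0 h).symm
    have p₄ : pos w = w.2 := by rw [pos, if_pos h0]
    have p₅ := hpos (S.min' hSne) (by omega)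
    have p₆ := hpos (S.max' hSne) (by omega)
    have := run_between hx hmin.2 hmax.2 hTL hwn (by omega) (by omega)
    omega

theorem pathsBoundCores_of_top (hx : IsOneRun x) (hTL : site N 0 0 ∈ run x (-s))
    (hTR : site N 0 (N + 1) ∈ run x (-s)) {w₀ : Site N} (hw₀ : w₀ ∈ run x s)
    (hw₀' : (w₀.1 : ℕ) = 0) (t : ℤˣ) : PathsBoundCores x t := by
  obtain ⟨a, b, h⟩ := exists_isTopRun hx hTL hTR hw₀ hw₀'
  rcases units_eq_or s t with rfl | rfl
  · exact h.pathsBoundCores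
  · exact h.pathsBoundCores_neg

theorem pathsBoundCores_of_left (hx : IsOneRun x) (hTL : site N 0 0 ∈ run x (-s))
    (hBL : site N (N + 1) 0 ∈ run x (-s)) {w₀ : Site N} (hw₀ : w₀ ∈ run x s)
    (hw₀' : (w₀.2 : ℕ) = 0) (t : ℤˣ) : PathsBoundCores x t := by
  obtain ⟨x', hx'⟩ := isReflection_transpose.exists_reflects x
  refine hx'.pathsBoundCores (pathsBoundCores_of_top (hx'.isOneRun hx) ((hx'.mem_run _ _).2 hTL)
    ((hx'.mem_run _ _).2 hBL) ((hx'.symm.mem_run _ _).1 hw₀) hw₀' t)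

theorem pathsBoundCores_of_corners_eq (hx : IsOneRun x) (hTL : site N 0 0 ∈ run x (-s))
    (hTR : site N 0 (N + 1) ∈ run x (-s)) (hBL : site N (N + 1) 0 ∈ run x (-s))
    (hBR : site N (N + 1) (N + 1) ∈ run x (-s)) (t : ℤˣ) : PathsBoundCores x t := by
  obtain ⟨w₀, hw₀⟩ := run_nonempty hx s
  rcases mem_boundary_iff.1 hw₀.1 with h | h | h | h
  · exact pathsBoundCores_of_top hx hTL hTR hw₀ h t
  · obtain ⟨x', hx'⟩ := isReflection_flipRows.exists_reflects x
    refine hx'.pathsBoundCores (pathsBoundCores_of_top (hx'.isOneRun hx) ?_ ?_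
      ((hx'.symm.mem_run _ _).1 hw₀) (by rw [flipRows_fst]; omega) t)
    · rw [hx'.mem_run, flipRows_site (by omega) (by omega)]; exact hBL
    · rw [hx'.mem_run, flipRows_site (by omega) (by omega)]; exact hBR
  · exact pathsBoundCores_of_left hx hTL hBL hw₀ h t
  · obtain ⟨x', hx'⟩ := isReflection_flipCols.exists_reflects x
    refine hx'.pathsBoundCores (pathsBoundCores_of_left (hx'.isOneRun hx) ?_ ?_
      ((hx'.symm.mem_run _ _).1 hw₀) (by rw [flipCols_snd]; omega) t)
    · rw [hx'.mem_run, flipCols_site (by omega) (by omega)]; exact hTR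
    · rw [hx'.mem_run, flipCols_site (by omega) (by omega)]; exact hBR

theorem pathsBoundCores_of_diagonal (hx : IsOneRun x) (hTL : site N 0 0 ∈ run x s)
    (hBR : site N (N + 1) (N + 1) ∈ run x (-s)) (t : ℤˣ) : PathsBoundCores x t := by
  rcases units_eq_or s t with rfl | rfl
  · obtain ⟨x', hx'⟩ := isReflection_flipRows.exists_reflects x
    refine hx'.pathsBoundCores (pathsBoundCores_of_corners (hx'.isOneRun hx) ?_ ?_)
    · rw [hx'.mem_run, flipRows_site (by omega) (by omega), Nat.sub_self]; exact hTL
    · rw [hx'.mem_run, flipRows_site (by omega) (by omega)]; exact hBR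
  · obtain ⟨x', hx'⟩ := isReflection_flipCols.exists_reflects x
    refine hx'.pathsBoundCores (pathsBoundCores_of_corners (hx'.isOneRun hx) ?_ ?_)
    · rw [hx'.mem_run, flipCols_site (by omega) (by omega)]; exact hBR
    · rw [hx'.mem_run, flipCols_site (by omega) (by omega), Nat.sub_self, neg_neg]; exact hTL

theorem pathsBoundCores_of_antidiagonal (hx : IsOneRun x) (hBL : site N (N + 1) 0 ∈ run x s)
    (hTR : site N 0 (N + 1) ∈ run x (-s)) (t : ℤˣ) : PathsBoundCores x t := by
  obtain ⟨x', hx'⟩ := isReflection_flipRows.exists_reflects x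
  refine hx'.pathsBoundCores (pathsBoundCores_of_diagonal (s := s) (hx'.isOneRun hx) ?_ ?_ t)
  · rw [hx'.mem_run, flipRows_site (by omega) (by omega)]; exact hBL
  · rw [hx'.mem_run, flipRows_site (by omega) (by omega), Nat.sub_self]; exact hTR

/-- Either some two opposite corners differ, or all four corners agree. The remaining pattern, with
equal signs on each diagonal but different ones on the two diagonals, alternates around the cycle.
-/
theorem pathsBoundCores_of_isOneRun (hx : IsOneRun x) (t : ℤˣ) : PathsBoundCores x t := by
  have hcorner : ∀ i j, i = 0 ∨ i = N + 1 → j = 0 ∨ j = N + 1 → site N i j ∈ boundary N := by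
    intro i j hi hj
    rw [mem_boundary_iff, site_fst (by omega), site_snd (by omega)]
    omega
  have hTLb := hcorner 0 0 (by omega) (by omega)
  have hTRb := hcorner 0 (N + 1) (by omega) (by omega)
  have hBLb := hcorner (N + 1) 0 (by omega) (by omega)
  have hBRb := hcorner (N + 1) (N + 1) (by omega) (by omega)
  obtain ⟨s, hTL⟩ : ∃ s, site N 0 0 ∈ run x (-s) := by
    rcases mem_run_or 1 hTLb with h | h
    · exact ⟨-1, by rwa [neg_neg]⟩
    · exact ⟨1, h⟩
  rcases mem_run_or s hBRb with hBR | hBR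
  · exact pathsBoundCores_of_diagonal hx hTL (by rwa [neg_neg]) t
  rcases mem_run_or s hBLb with hBL | hBL <;> rcases mem_run_or s hTRb with hTR | hTR
  · exfalso
    have p₁ : pos (site N 0 0) = 0 := by
      rw [pos, site_fst (by omega), site_snd (by omega), if_pos rfl]
    have p₂ : pos (site N 0 (N + 1)) = N + 1 := by
      rw [pos, site_fst (by omega), site_snd (by omega), if_pos rfl]
    have p₃ : pos (site N (N + 1) (N + 1)) = 2 * (N + 1) := by
      rw [pos, site_fst (by omega), site_snd (by omega)]
      rw [if_neg (by omega), if_pos rfl]; omega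
    have p₄ : pos (site N (N + 1) 0) = 3 * (N + 1) := by
      rw [pos, site_fst (by omega), site_snd (by omega)]
      split_ifs <;> omega
    have := run_between hx hTR hBL hTL hBR (by omega) (by omega)
    omega
  · exact pathsBoundCores_of_antidiagonal hx hBL hTR t
  · exact pathsBoundCores_of_antidiagonal hx hBL (by rwa [neg_neg]) t
  · exact pathsBoundCores_of_corners_eq hx hTL hTR hBL hBR t

end TopRun

/-! ### Sign changes along lines -/

theorem units_eq_of_ne {s t u : ℤˣ} (h₁ : s ≠ t) (h₂ : t ≠ u) : s = u := by
  rcases units_eq_or t s with h | h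
  · exact absurd h h₁
  · rcases units_eq_or t u with h' | h'
    · exact absurd h'.symm h₂
    · rw [h, h']

/-- The number of sign changes of a line between the places `a` and `b`. -/
def signChanges (f : ℕ → ℤˣ) (a b : ℕ) : ℕ :=
  ∑ j ∈ Finset.Ico a b, if f j ≠ f (j + 1) then 1 else 0

theorem signChanges_add (f : ℕ → ℤˣ) {a b c : ℕ} (hab : a ≤ b) (hbc : b ≤ c) :
    signChanges f a b + signChanges f b c = signChanges f a c :=
  Finset.sum_Ico_consecutive _ hab hbc

theorem signChanges_pos {f : ℕ → ℤˣ} {a b : ℕ} (hab : a ≤ b) (h : f a ≠ f b) :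
    1 ≤ signChanges f a b := by
  by_contra! hlt
  have h0 : signChanges f a b = 0 := by omega
  rw [signChanges, Finset.sum_eq_zero_iff] at h0
  refine h ?_
  clear h hlt
  induction b, hab using Nat.le_induction with
  | base => rfl
  | succ k hk ih =>
    rw [ih fun j hj => h0 j (by rw [Finset.mem_Ico] at hj ⊢; omega)]
    have := h0 k (by rw [Finset.mem_Ico]; omega)
    by_contra hne
    rw [if_pos hne] at this
    omega

/-- A line with at most one sign change, and none if its ends agree. -/
def IsTight (f : ℕ → ℤˣ) (m : ℕ) : Prop :=
  signChanges f 0 m ≤ if f 0 ≠ f m then 1 else 0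

theorem isTight_of {f : ℕ → ℤˣ} {m : ℕ} (hconst : f 0 = f m → ∀ j ≤ m, f j = f 0)
    (hmono : f 0 ≠ f m → ∀ i j, i < j → j ≤ m → f j = f 0 → f i = f 0) : IsTight f m := by
  unfold IsTight
  split_ifs with h
  · obtain ⟨l, hl, hlf⟩ := exists_last (p := fun k => f k = f 0) rfl (Ne.symm h) (hmono h)
    rw [signChanges, Finset.sum_eq_single_of_mem l (Finset.mem_Ico.2 ⟨Nat.zero_le _, hl⟩)]
    · split_ifs <;> omega
    · intro j hj hjl
      rw [Finset.mem_Ico] at hj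
      rw [if_neg]
      rw [not_not]
      rcases Nat.lt_or_ge j l with h' | h'
      · rw [(hlf j (by omega)).2 (by omega), (hlf (j + 1) (by omega)).2 (by omega)]
      · have h₁ : f 0 ≠ f j := fun h => absurd ((hlf j (by omega)).1 h.symm) (by omega)
        have h₂ : f (j + 1) ≠ f 0 := fun h => absurd ((hlf (j + 1) (by omega)).1 h) (by omega)
        exact (units_eq_of_ne h₂ h₁).symm
  · rw [not_not] at h
    have hc := hconst h
    refine (Finset.sum_eq_zero fun j hj => ?_).le
    rw [Finset.mem_Ico] at hj
    rw [if_neg]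
    rw [not_not, hc j (by omega), hc (j + 1) (by omega)]

/-- Tight lines have the fewest sign changes among all lines with the same ends. -/
theorem IsTight.le {f g : ℕ → ℤˣ} {m : ℕ} (hg : IsTight g m) (h0 : f 0 = g 0) (hm : f m = g m) :
    signChanges g 0 m ≤ signChanges f 0 m := by
  refine hg.trans ?_
  split_ifs with h
  · exact signChanges_pos (Nat.zero_le m) (by rwa [h0, hm])
  · exact Nat.zero_le _

/-- A parity argument. If exactly one of the two outer segments has a forced change, then `f`
changes at least twice while its ends agree, so `g` does not change. If both have one, `f` changes
three times and `g` at most once. -/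
theorem IsTight.add_two_le {f g : ℕ → ℤˣ} {m k k' : ℕ} (hg : IsTight g m) (h0 : f 0 = g 0)
    (hm : f m = g m) (hkk' : k ≤ k') (hk' : k' ≤ m) (hne : f k ≠ f k')
    (h : f 0 ≠ f k ∨ f k' ≠ f m) : signChanges g 0 m + 2 ≤ signChanges f 0 m := by
  unfold IsTight at hg
  have h₁ := signChanges_pos hkk' hne
  have h₂ := signChanges_add f (Nat.zero_le k) hkk'
  have h₃ := signChanges_add f (Nat.zero_le k') hk'
  rw [← h0, ← hm] at hg
  by_cases ha : f 0 ≠ f k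
  · have h₄ := signChanges_pos (Nat.zero_le k) ha
    by_cases hb : f k' ≠ f m
    · have h₅ := signChanges_pos hk' hb
      split_ifs at hg <;> omega
    · rw [not_not] at hb
      rw [if_neg (not_not.2 ((units_eq_of_ne ha hne).trans hb))] at hg
      omega
  · have hb := h.resolve_left ha
    have h₅ := signChanges_pos hk' hb
    rw [not_not] at ha
    rw [if_neg (not_not.2 (ha.trans (units_eq_of_ne hne hb)))] at hg
    omega

theorem signChanges_congr {f g : ℕ → ℤˣ} {a b : ℕ} (h : ∀ j, a ≤ j → j ≤ b → f j = g j) :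
    signChanges f a b = signChanges g a b := by
  refine Finset.sum_congr rfl fun j hj => ?_
  rw [Finset.mem_Ico] at hj
  rw [h j (by omega) (by omega), h (j + 1) (by omega) (by omega)]

theorem signChanges_succ (f : ℕ → ℤˣ) (a : ℕ) :
    signChanges f a (a + 1) = if f a ≠ f (a + 1) then 1 else 0 := by
  rw [signChanges, Nat.Ico_succ_singleton, Finset.sum_singleton]

/-- The effect of a change of one sign on the number of sign changes. -/
theorem signChanges_flip_le {f g : ℕ → ℤˣ} {i m : ℕ} (hi : i + 1 < m)
    (h : ∀ j, j ≠ i + 1 → g j = f j) : signChanges g 0 m ≤ signChanges f 0 m + 2 ∧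
      (g (i + 1) ≠ f (i + 1) → (f i ≠ f (i + 1) ∨ f (i + 1) ≠ f (i + 2)) →
        signChanges g 0 m ≤ signChanges f 0 m) := by
  have hdec : ∀ f : ℕ → ℤˣ, signChanges f 0 m = signChanges f 0 i +
      (if f i ≠ f (i + 1) then 1 else 0) + (if f (i + 1) ≠ f (i + 2) then 1 else 0) +
        signChanges f (i + 2) m := fun f => by
    rw [← signChanges_succ, ← signChanges_succ, signChanges_add _ (by omega) (by omega),
      signChanges_add _ (by omega) (by omega), signChanges_add _ (by omega) (by omega)]
  rw [hdec f, hdec g, signChanges_congr (f := g) (g := f) (a := 0) fun j _ _ => h j (by omega),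
    signChanges_congr (f := g) (g := f) (a := i + 2) fun j _ _ => h j (by omega),
    h i (by omega), h (i + 2) (by omega)]
  constructor
  · split_ifs <;> omega
  · rintro hne (h' | h')
    · rw [if_pos h', if_neg (not_not.2 (units_eq_of_ne h' hne.symm))]
      split_ifs <;> omega
    · rw [if_pos h', if_neg (not_not.2 (units_eq_of_ne hne h'))]
      split_ifs <;> omega

/-! ### Sign changes in arrays -/

/-- The number of sign changes in the rows and the columns `1, …, N` of an array with the index
range `0, …, N + 1`. -/
def totalChanges (N : ℕ) (X : ℕ → ℕ → ℤˣ) : ℕ :=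
  ∑ r ∈ Finset.Icc 1 N, signChanges (X r) 0 (N + 1) +
    ∑ c ∈ Finset.Icc 1 N, signChanges (fun i => X i c) 0 (N + 1)

theorem totalChanges_swap (N : ℕ) (X : ℕ → ℕ → ℤˣ) :
    totalChanges N (fun i j => X j i) = totalChanges N X := add_comm _ _

theorem sum_add_le_sum {N a b k l : ℕ} {f g : ℕ → ℕ} (ha : a ∈ Finset.Icc 1 N)
    (hb : b ∈ Finset.Icc 1 N)
    (h : ∀ r ∈ Finset.Icc 1 N, f r + ((if r = a then k else 0) + if r = b then l else 0) ≤ g r) :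
    ∑ r ∈ Finset.Icc 1 N, f r + (k + l) ≤ ∑ r ∈ Finset.Icc 1 N, g r := by
  have := Finset.sum_le_sum h
  rwa [Finset.sum_add_distrib, Finset.sum_add_distrib, Finset.sum_ite_eq' _ a,
    Finset.sum_ite_eq' _ b, if_pos ha, if_pos hb] at this

theorem sum_le_sum_add {N a k : ℕ} {f g : ℕ → ℕ} (ha : a ∈ Finset.Icc 1 N)
    (h : ∀ r ∈ Finset.Icc 1 N, f r ≤ g r + if r = a then k else 0) :
    ∑ r ∈ Finset.Icc 1 N, f r ≤ ∑ r ∈ Finset.Icc 1 N, g r + k := by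
  have := Finset.sum_le_sum h
  rwa [Finset.sum_add_distrib, Finset.sum_ite_eq' _ a, if_pos ha] at this

/-- `X₀` is an array with tight rows and columns, and `X` has the same sides. -/
structure IsTightFor (N : ℕ) (X₀ X : ℕ → ℕ → ℤˣ) : Prop where
  row_tight : ∀ r ∈ Finset.Icc 1 N, IsTight (X₀ r) (N + 1)
  col_tight : ∀ c ∈ Finset.Icc 1 N, IsTight (fun i => X₀ i c) (N + 1)
  left : ∀ r ∈ Finset.Icc 1 N, X r 0 = X₀ r 0
  right : ∀ r ∈ Finset.Icc 1 N, X r (N + 1) = X₀ r (N + 1)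
  top : ∀ c ∈ Finset.Icc 1 N, X 0 c = X₀ 0 c
  bottom : ∀ c ∈ Finset.Icc 1 N, X (N + 1) c = X₀ (N + 1) c

namespace IsTightFor

variable {N : ℕ} {X₀ X : ℕ → ℕ → ℤˣ}

theorem swap (h : IsTightFor N X₀ X) : IsTightFor N (fun i j => X₀ j i) (fun i j => X j i) :=
  ⟨h.col_tight, h.row_tight, h.top, h.bottom, h.left, h.right⟩

theorem row_le (h : IsTightFor N X₀ X) {r : ℕ} (hr : r ∈ Finset.Icc 1 N) :
    signChanges (X₀ r) 0 (N + 1) ≤ signChanges (X r) 0 (N + 1) :=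
  (h.row_tight r hr).le (h.left r hr) (h.right r hr)

theorem rows_le (h : IsTightFor N X₀ X) : ∑ r ∈ Finset.Icc 1 N, signChanges (X₀ r) 0 (N + 1) ≤
    ∑ r ∈ Finset.Icc 1 N, signChanges (X r) 0 (N + 1) :=
  Finset.sum_le_sum fun _ hr => h.row_le hr

theorem cols_le (h : IsTightFor N X₀ X) :
    ∑ c ∈ Finset.Icc 1 N, signChanges (fun i => X₀ i c) 0 (N + 1) ≤
      ∑ c ∈ Finset.Icc 1 N, signChanges (fun i => X i c) 0 (N + 1) :=
  h.swap.rows_le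

theorem total_le (h : IsTightFor N X₀ X) : totalChanges N X₀ ≤ totalChanges N X :=
  Nat.add_le_add h.rows_le h.cols_le

/-- Extra sign changes in two different rows add up. -/
theorem rows_add_le (h : IsTightFor N X₀ X) {a b k l : ℕ} (ha : a ∈ Finset.Icc 1 N)
    (hb : b ∈ Finset.Icc 1 N) (hab : a ≠ b)
    (hak : signChanges (X₀ a) 0 (N + 1) + k ≤ signChanges (X a) 0 (N + 1))
    (hbl : signChanges (X₀ b) 0 (N + 1) + l ≤ signChanges (X b) 0 (N + 1)) :
    ∑ r ∈ Finset.Icc 1 N, signChanges (X₀ r) 0 (N + 1) + (k + l) ≤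
      ∑ r ∈ Finset.Icc 1 N, signChanges (X r) 0 (N + 1) := by
  refine sum_add_le_sum ha hb fun r hr => ?_
  have := h.row_le hr
  split_ifs with h₁ h₂ h₂
  · exact absurd (h₁.symm.trans h₂) hab
  · subst h₁; omega
  · subst h₂; omega
  · omega

theorem row_add_two_le (h : IsTightFor N X₀ X) {a : ℕ} (ha : a ∈ Finset.Icc 1 N)
    (hak : signChanges (X₀ a) 0 (N + 1) + 2 ≤ signChanges (X a) 0 (N + 1)) :
    ∑ r ∈ Finset.Icc 1 N, signChanges (X₀ r) 0 (N + 1) + 2 ≤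
      ∑ r ∈ Finset.Icc 1 N, signChanges (X r) 0 (N + 1) := by
  refine sum_add_le_sum (l := 0) ha ha fun r hr => ?_
  have := h.row_le hr
  split_ifs with h₁
  · subst h₁; omega
  · omega

theorem line_add_two_le (h : IsTightFor N X₀ X) {r c : ℕ} {s : ℤˣ} (hr : r ∈ Finset.Icc 1 N)
    (hc : c ≤ N + 1) (hX : X r c ≠ s) (h0 : X r 0 = s) (hm : X r (N + 1) = s) :
    signChanges (X₀ r) 0 (N + 1) + 2 ≤ signChanges (X r) 0 (N + 1) :=
  (h.row_tight r hr).add_two_le (k := c) (k' := N + 1) (h.left r hr) (h.right r hr) hc le_rfl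
    (hm ▸ hX) (Or.inl (h0 ▸ hX.symm))

theorem total_add_two_le (h : IsTightFor N X₀ X) {r c : ℕ} {s : ℤˣ} (hr : r ∈ Finset.Icc 1 N)
    (hc : c ≤ N + 1) (hX : X r c ≠ s) (h0 : X r 0 = s) (hm : X r (N + 1) = s) :
    totalChanges N X₀ + 2 ≤ totalChanges N X := by
  have h₁ := h.row_add_two_le hr (h.line_add_two_le hr hc hX h0 hm)
  have h₂ := h.cols_le
  unfold totalChanges
  omega

/-- Row `r` already costs 2, and if column `c` also has both ends `s`, it costs 2 more. Otherwise
take the neighbour of the site in column `c` towards an end that is not `s`. By `hnb` it is not this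
end, and its row has both ends `s`. If the neighbour is not `s`, its row costs 2; if it is `s`,
column `c` changes on both sides of it and has 2 superfluous changes. -/
theorem total_add_four_le (h : IsTightFor N X₀ X) {r c : ℕ} {s : ℤˣ} (hr : r ∈ Finset.Icc 1 N)
    (hc : c ∈ Finset.Icc 1 N) (hX : X r c ≠ s) (h0 : X r 0 = s) (hm : X r (N + 1) = s)
    (hnb : ∀ r', r' + 1 = r ∨ r + 1 = r' → (r' = 0 ∨ r' = N + 1 → X r' c = s) ∧
      (r' ∈ Finset.Icc 1 N → (X r' 0 = s ∧ X r' (N + 1) = s) ∨ X 0 c = s ∧ X (N + 1) c = s)) :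
    totalChanges N X₀ + 4 ≤ totalChanges N X := by
  rw [Finset.mem_Icc] at hr hc
  have hr' : r ∈ Finset.Icc 1 N := Finset.mem_Icc.2 hr
  have hc' : c ∈ Finset.Icc 1 N := Finset.mem_Icc.2 hc
  have hrow := h.line_add_two_le hr' (by omega) hX h0 hm
  have hrows := h.row_add_two_le hr' hrow
  have hcols := h.cols_le
  have hcol : signChanges (fun i => X₀ i c) 0 (N + 1) + 2 ≤
      signChanges (fun i => X i c) 0 (N + 1) → totalChanges N X₀ + 4 ≤ totalChanges N X := by
    intro h₁
    have := h.swap.row_add_two_le hc' h₁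
    unfold totalChanges
    omega
  by_cases hboth : X 0 c = s ∧ X (N + 1) c = s
  · exact hcol (h.swap.line_add_two_le hc' (by omega) hX hboth.1 hboth.2)
  have key : ∀ r', r' + 1 = r ∨ r + 1 = r' → r' ∈ Finset.Icc 1 N → X r' c ≠ s →
      totalChanges N X₀ + 4 ≤ totalChanges N X := by
    intro r' hrr' hr'N hX'
    have hends := ((hnb r' hrr').2 hr'N).resolve_right hboth
    have := h.rows_add_le hr' hr'N (by omega) hrow
      (h.line_add_two_le hr'N (by omega) hX' hends.1 hends.2)
    unfold totalChanges
    omega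
  by_cases htop : X 0 c = s
  · have hbot : X (N + 1) c ≠ s := fun h => hboth ⟨htop, h⟩
    obtain ⟨h₁, h₂⟩ := hnb (r + 1) (Or.inr rfl)
    have hrN : r + 1 ≠ N + 1 := fun h => hbot (h ▸ h₁ (Or.inr h))
    by_cases hX' : X (r + 1) c = s
    · refine hcol ((h.col_tight c hc').add_two_le (f := fun i => X i c) (k := r) (k' := r + 1)
        (h.top c hc') (h.bottom c hc') (by omega) (by omega) ?_ (Or.inr ?_))
      · exact fun he => hX (he.trans hX')
      · exact fun he => hbot (he.symm.trans hX')
    · exact key (r + 1) (Or.inr rfl) (Finset.mem_Icc.2 (by omega)) hX'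
  · obtain ⟨h₁, h₂⟩ := hnb (r - 1) (Or.inl (by omega))
    have hr0 : r - 1 ≠ 0 := fun h => htop (h ▸ h₁ (Or.inl h))
    by_cases hX' : X (r - 1) c = s
    · refine hcol ((h.col_tight c hc').add_two_le (f := fun i => X i c) (k := r - 1) (k' := r)
        (h.top c hc') (h.bottom c hc') (by omega) (by omega) ?_ (Or.inl ?_))
      · exact fun he => hX (he.symm.trans hX')
      · exact fun he => htop (he.trans hX')
    · exact key (r - 1) (Or.inl (by omega)) (Finset.mem_Icc.2 (by omega)) hX'

end IsTightFor

/-- The effect of a change of one sign on the total number of sign changes. -/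
theorem totalChanges_flip_le {N r c : ℕ} {X X' : ℕ → ℕ → ℤˣ} (hr : r ∈ Finset.Icc 1 N)
    (hc : c ∈ Finset.Icc 1 N) (h : ∀ i j, ¬ (i = r ∧ j = c) → X' i j = X i j) :
    totalChanges N X' ≤ totalChanges N X + 4 ∧
      (X' r c ≠ X r c → (X r (c - 1) ≠ X r c ∨ X r (c + 1) ≠ X r c ∨ X (r - 1) c ≠ X r c ∨
        X (r + 1) c ≠ X r c) → totalChanges N X' ≤ totalChanges N X + 2) := by
  have hr₁ := Finset.mem_Icc.1 hr
  have hc₁ := Finset.mem_Icc.1 hc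
  obtain ⟨r, rfl⟩ : ∃ k, r = k + 1 := ⟨r - 1, by omega⟩
  obtain ⟨c, rfl⟩ : ∃ k, c = k + 1 := ⟨c - 1, by omega⟩
  obtain ⟨hrow, hrow'⟩ := signChanges_flip_le (f := X (r + 1)) (g := X' (r + 1)) (i := c)
    (m := N + 1) (by omega) fun j hj => h _ _ (by omega)
  obtain ⟨hcol, hcol'⟩ := signChanges_flip_le (f := fun i => X i (c + 1))
    (g := fun i => X' i (c + 1)) (i := r) (m := N + 1) (by omega) fun j hj => h _ _ (by omega)
  have hrows : ∀ k, signChanges (X' (r + 1)) 0 (N + 1) ≤ signChanges (X (r + 1)) 0 (N + 1) + k →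
      ∑ i ∈ Finset.Icc 1 N, signChanges (X' i) 0 (N + 1) ≤
        ∑ i ∈ Finset.Icc 1 N, signChanges (X i) 0 (N + 1) + k := by
    intro k hk
    refine sum_le_sum_add hr fun i _ => ?_
    split_ifs with hi
    · subst hi; exact hk
    · exact (signChanges_congr fun j _ _ => h i j (by omega)).le
  have hcols : ∀ k, signChanges (fun i => X' i (c + 1)) 0 (N + 1) ≤
      signChanges (fun i => X i (c + 1)) 0 (N + 1) + k →
      ∑ j ∈ Finset.Icc 1 N, signChanges (fun i => X' i j) 0 (N + 1) ≤
        ∑ j ∈ Finset.Icc 1 N, signChanges (fun i => X i j) 0 (N + 1) + k := by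
    intro k hk
    refine sum_le_sum_add hc fun j _ => ?_
    split_ifs with hj
    · subst hj; exact hk
    · exact (signChanges_congr fun i _ _ => h i j (by omega)).le
  have h₁ := hrows 2 hrow
  have h₂ := hcols 2 hcol
  unfold totalChanges
  refine ⟨by omega, fun hne hnb => ?_⟩
  simp only [Nat.add_sub_cancel] at hnb
  rcases hnb with h' | h' | h' | h'
  · have := hrows 0 (hrow' hne (Or.inl h'))
    omega
  · have := hrows 0 (hrow' hne (Or.inr h'.symm))
    omega
  · have := hcols 0 (hcol' hne (Or.inl h'))
    omega
  · have := hcols 0 (hcol' hne (Or.inr h'.symm))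
    omega

/-! ### Odd bonds as sign changes -/

theorem sum_signChanges_eq_card (N : ℕ) (X : ℕ → ℕ → ℤˣ) :
    ∑ r ∈ Finset.Icc 1 N, signChanges (X r) 0 (N + 1) =
      ((Finset.Icc 1 N ×ˢ Finset.Ico 0 (N + 1)).filter
        fun p => X p.1 p.2 ≠ X p.1 (p.2 + 1)).card := by
  rw [Finset.card_filter, Finset.sum_product]
  rfl

/-- The array of the values of a configuration. -/
noncomputable def values (x : BoundaryConfig N) (y : InteriorConfig N) (i j : ℕ) : ℤˣ :=
  glue x y (site N i j)

theorem site_inj {i j i' j' : ℕ} (hi : i ≤ N + 1) (hj : j ≤ N + 1) (hi' : i' ≤ N + 1)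
    (hj' : j' ≤ N + 1) (h : site N i j = site N i' j') : i = i' ∧ j = j' := by
  have h₁ := congrArg (fun z : Site N => (z.1 : ℕ)) h
  have h₂ := congrArg (fun z : Site N => (z.2 : ℕ)) h
  simp only [site_fst hi, site_fst hi'] at h₁
  simp only [site_snd hj, site_snd hj'] at h₂
  exact ⟨h₁, h₂⟩

/-- An edge meets `B` exactly if it is a horizontal edge of an interior row or a vertical edge of an
interior column; `φ` and `ψ` parametrize these two kinds. -/
theorem oddBonds_eq_totalChanges (x : BoundaryConfig N) (y : InteriorConfig N) :
    oddBonds x y = totalChanges N (values x y) := by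
  let H := (Finset.Icc 1 N ×ˢ Finset.Ico 0 (N + 1)).filter
    fun p => values x y p.1 p.2 ≠ values x y p.1 (p.2 + 1)
  let K := (Finset.Icc 1 N ×ˢ Finset.Ico 0 (N + 1)).filter
    fun p => values x y p.2 p.1 ≠ values x y (p.2 + 1) p.1
  let φ : ℕ × ℕ → Sym2 (Site N) := fun p => s(site N p.1 p.2, site N p.1 (p.2 + 1))
  let ψ : ℕ × ℕ → Sym2 (Site N) := fun p => s(site N p.2 p.1, site N (p.2 + 1) p.1)
  have hH : ∀ p, p ∈ H ↔ (1 ≤ p.1 ∧ p.1 ≤ N ∧ p.2 < N + 1) ∧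
      glue x y (site N p.1 p.2) ≠ glue x y (site N p.1 (p.2 + 1)) := fun p => by
    refine Finset.mem_filter.trans (and_congr ?_ Iff.rfl)
    rw [Finset.mem_product, Finset.mem_Icc, Finset.mem_Ico]
    omega
  have hK : ∀ p, p ∈ K ↔ (1 ≤ p.1 ∧ p.1 ≤ N ∧ p.2 < N + 1) ∧
      glue x y (site N p.2 p.1) ≠ glue x y (site N (p.2 + 1) p.1) := fun p => by
    refine Finset.mem_filter.trans (and_congr ?_ Iff.rfl)
    rw [Finset.mem_product, Finset.mem_Icc, Finset.mem_Ico]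
    omega
  have hφ : Set.InjOn φ (H : Set (ℕ × ℕ)) := by
    intro p hp q hq h
    have h₁ := ((hH p).1 hp).1
    have h₂ := ((hH q).1 hq).1
    rcases Sym2.eq_iff.1 h with ⟨ha, hb⟩ | ⟨ha, hb⟩
    · have := site_inj (by omega) (by omega) (by omega) (by omega) ha
      exact Prod.ext this.1 this.2
    · have h₃ := site_inj (by omega) (by omega) (by omega) (by omega) ha
      have h₄ := site_inj (by omega) (by omega) (by omega) (by omega) hb
      omega
  have hψ : Set.InjOn ψ (K : Set (ℕ × ℕ)) := by
    intro p hp q hq h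
    have h₁ := ((hK p).1 hp).1
    have h₂ := ((hK q).1 hq).1
    rcases Sym2.eq_iff.1 h with ⟨ha, hb⟩ | ⟨ha, hb⟩
    · have := site_inj (by omega) (by omega) (by omega) (by omega) ha
      exact Prod.ext this.2 this.1
    · have h₃ := site_inj (by omega) (by omega) (by omega) (by omega) ha
      have h₄ := site_inj (by omega) (by omega) (by omega) (by omega) hb
      omega
  have hdisj : Disjoint (φ '' (H : Set (ℕ × ℕ))) (ψ '' (K : Set (ℕ × ℕ))) := by
    rw [Set.disjoint_left]
    rintro _ ⟨p, hp, rfl⟩ ⟨q, hq, h⟩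
    have h₁ := ((hH p).1 hp).1
    have h₂ := ((hK q).1 hq).1
    rcases Sym2.eq_iff.1 h with ⟨ha, hb⟩ | ⟨ha, hb⟩
    · have h₃ := site_inj (by omega) (by omega) (by omega) (by omega) ha
      have h₄ := site_inj (by omega) (by omega) (by omega) (by omega) hb
      omega
    · have h₃ := site_inj (by omega) (by omega) (by omega) (by omega) ha
      have h₄ := site_inj (by omega) (by omega) (by omega) (by omega) hb
      omega
  have hset : {e : Sym2 (Site N) | e ∈ (grid N).edgeSet ∧ (∃ i ∈ e, i ∈ interior N) ∧
      ∃ i ∈ e, ∃ j ∈ e, glue x y i ≠ glue x y j} =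
      φ '' (H : Set (ℕ × ℕ)) ∪ ψ '' (K : Set (ℕ × ℕ)) := by
    apply Set.Subset.antisymm
    · intro e
      induction e using Sym2.ind with
      | _ a b =>
        rintro ⟨hadj, ⟨i, hi, hiB⟩, j, hj, k, hk, hne⟩
        have hab : glue x y a ≠ glue x y b := by
          intro hab
          rw [Sym2.mem_iff] at hj hk
          rcases hj with rfl | rfl <;> rcases hk with rfl | rfl <;> simp_all
        have hint : a ∈ interior N ∨ b ∈ interior N := by
          rw [Sym2.mem_iff] at hi
          rcases hi with rfl | rfl
          · exact Or.inl hiB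
          · exact Or.inr hiB
        clear hi hiB hj hk hne
        rw [SimpleGraph.mem_edgeSet, grid_adj_iff] at hadj
        rw [mem_interior_iff, mem_interior_iff] at hint
        have hvert : ∀ a b : Site N, (a.1 : ℕ) + 1 = b.1 → (a.2 : ℕ) = b.2 →
            glue x y a ≠ glue x y b → 1 ≤ (a.2 : ℕ) → (a.2 : ℕ) ≤ N →
            s(a, b) ∈ ψ '' (K : Set (ℕ × ℕ)) := by
          intro a b h₁ h₂ h₃ h₄ h₅
          have := b.fst_le
          have hb : b = site N (a.1 + 1) a.2 := eq_site h₁.symm h₂.symm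
          refine ⟨(a.2, a.1), (hK _).2 ⟨⟨h₄, h₅, by omega⟩, ?_⟩, ?_⟩
          · dsimp only
            rwa [← hb, site_coords]
          · simp only [ψ]
            rw [← hb, site_coords]
        have hhor : ∀ a b : Site N, (a.2 : ℕ) + 1 = b.2 → (a.1 : ℕ) = b.1 →
            glue x y a ≠ glue x y b → 1 ≤ (a.1 : ℕ) → (a.1 : ℕ) ≤ N →
            s(a, b) ∈ φ '' (H : Set (ℕ × ℕ)) := by
          intro a b h₁ h₂ h₃ h₄ h₅
          have := b.snd_le
          have hb : b = site N a.1 (a.2 + 1) := eq_site h₂.symm h₁.symm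
          refine ⟨(a.1, a.2), (hH _).2 ⟨⟨h₄, h₅, by omega⟩, ?_⟩, ?_⟩
          · dsimp only
            rwa [← hb, site_coords]
          · simp only [φ]
            rw [← hb, site_coords]
        rcases hadj with ⟨h₁ | h₁, h₂⟩ | ⟨h₁ | h₁, h₂⟩
        · exact Or.inr (hvert a b h₁ h₂ hab (by omega) (by omega))
        · exact Or.inr (Sym2.eq_swap ▸ hvert b a h₁ h₂.symm hab.symm (by omega) (by omega))
        · exact Or.inl (hhor a b h₁ h₂ hab (by omega) (by omega))
        · exact Or.inl (Sym2.eq_swap ▸ hhor b a h₁ h₂.symm hab.symm (by omega) (by omega))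
    · rintro e (⟨p, hp, rfl⟩ | ⟨p, hp, rfl⟩)
      · obtain ⟨h₁, h₂⟩ := (hH p).1 hp
        refine ⟨?_, ?_, _, Sym2.mem_mk_left _ _, _, Sym2.mem_mk_right _ _, h₂⟩
        · rw [SimpleGraph.mem_edgeSet, grid_adj_iff, site_fst (by omega), site_snd (by omega),
            site_fst (by omega), site_snd (by omega)]
          omega
        · rcases Nat.eq_zero_or_pos p.2 with h | h
          · refine ⟨_, Sym2.mem_mk_right _ _, ?_⟩
            rw [mem_interior_iff, site_fst (by omega), site_snd (by omega)]
            omega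
          · refine ⟨_, Sym2.mem_mk_left _ _, ?_⟩
            rw [mem_interior_iff, site_fst (by omega), site_snd (by omega)]
            omega
      · obtain ⟨h₁, h₂⟩ := (hK p).1 hp
        refine ⟨?_, ?_, _, Sym2.mem_mk_left _ _, _, Sym2.mem_mk_right _ _, h₂⟩
        · rw [SimpleGraph.mem_edgeSet, grid_adj_iff, site_fst (by omega), site_snd (by omega),
            site_fst (by omega), site_snd (by omega)]
          omega
        · rcases Nat.eq_zero_or_pos p.2 with h | h
          · refine ⟨_, Sym2.mem_mk_right _ _, ?_⟩
            rw [mem_interior_iff, site_fst (by omega), site_snd (by omega)]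
            omega
          · refine ⟨_, Sym2.mem_mk_left _ _, ?_⟩
            rw [mem_interior_iff, site_fst (by omega), site_snd (by omega)]
            omega
  rw [oddBonds, hset, Set.ncard_union_eq hdisj (Set.toFinite _) (Set.toFinite _),
    hφ.ncard_image, hψ.ncard_image, Set.ncard_coe_finset,
    Set.ncard_coe_finset, totalChanges, sum_signChanges_eq_card,
    sum_signChanges_eq_card N fun i j => values x y j i]

/-! ### Cores along lines -/

section Core

variable {x : BoundaryConfig N} {s : ℤˣ}

theorem mem_core_of_mem_boundary {v : Site N} (hv : v ∈ boundary N) :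
    v ∈ core x s ↔ v ∈ run x s :=
  ⟨fun h => h.resolve_right fun h' => hv h'.1, Or.inl⟩

theorem pos_left {r : ℕ} (h₁ : 1 ≤ r) (h₂ : r ≤ N) : pos (site N r 0) = 4 * (N + 1) - r := by
  rw [pos, site_fst (by omega), site_snd (by omega), if_neg (by omega), if_neg (by omega),
    if_neg (by omega)]

theorem pos_right {r : ℕ} (h₁ : 1 ≤ r) (h₂ : r ≤ N) : pos (site N r (N + 1)) = N + 1 + r := by
  rw [pos, site_fst (by omega), site_snd (by omega), if_neg (by omega), if_pos rfl]

theorem pos_top {c : ℕ} (h₂ : c ≤ N) : pos (site N 0 c) = c := by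
  rw [pos, site_fst (by omega), site_snd (by omega), if_pos rfl]

theorem pos_bottom {c : ℕ} (h₂ : c ≤ N) : pos (site N (N + 1) c) = 3 * (N + 1) - c := by
  rw [pos, site_fst (by omega), site_snd (by omega), if_neg (by omega), if_neg (by omega),
    if_pos rfl]

theorem site_mem_boundary {i j : ℕ} (hi : i ≤ N + 1) (hj : j ≤ N + 1)
    (h : i = 0 ∨ i = N + 1 ∨ j = 0 ∨ j = N + 1) : site N i j ∈ boundary N := by
  rwa [mem_boundary_iff, site_fst hi, site_snd hj]

theorem site_mem_interior {i j : ℕ} (hi : 1 ≤ i) (hi' : i ≤ N) (hj : 1 ≤ j) (hj' : j ≤ N) :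
    site N i j ∈ interior N := by
  rw [mem_interior_iff, site_fst (by omega), site_snd (by omega)]
  omega

theorem site_mem_core_iff {i j : ℕ} (hi : 1 ≤ i) (hi' : i ≤ N) (hj : 1 ≤ j) (hj' : j ≤ N) :
    site N i j ∈ core x s ↔ (site N i 0 ∈ run x s ∧ site N i (N + 1) ∈ run x s) ∨
      (site N 0 j ∈ run x s ∧ site N (N + 1) j ∈ run x s) := by
  have h := site_mem_interior hi hi' hj hj'
  rw [core, Set.mem_ofPred_eq, site_fst (by omega), site_snd (by omega)]
  exact ⟨fun h' => (h'.resolve_left fun h'' => h''.1 h).2, fun h' => Or.inr ⟨h, h'⟩⟩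

/-- Along a row, the core of a one-run configuration starts or ends at most once, and not at all
if the ends of the row have the same sign. -/
theorem core_row (hx : IsOneRun x) (s : ℤˣ) {r : ℕ} (hr : 1 ≤ r) (hr' : r ≤ N) :
    ((site N r 0 ∈ core x s ↔ site N r (N + 1) ∈ core x s) →
      ∀ j ≤ N + 1, (site N r j ∈ core x s ↔ site N r 0 ∈ core x s)) ∧
    (¬ (site N r 0 ∈ core x s ↔ site N r (N + 1) ∈ core x s) → ∀ i j, i < j → j ≤ N + 1 →
      (site N r j ∈ core x s ↔ site N r 0 ∈ core x s) →
        (site N r i ∈ core x s ↔ site N r 0 ∈ core x s)) := by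
  have hLb : site N r 0 ∈ boundary N := site_mem_boundary (by omega) (by omega) (by omega)
  have hRb : site N r (N + 1) ∈ boundary N := site_mem_boundary (by omega) (by omega) (by omega)
  have hTb : ∀ c ≤ N, site N 0 c ∈ boundary N := fun c hc =>
    site_mem_boundary (by omega) (by omega) (by omega)
  have hBb : ∀ c ≤ N, site N (N + 1) c ∈ boundary N := fun c hc =>
    site_mem_boundary (by omega) (by omega) (by omega)
  have pL := pos_left hr hr'
  have pR := pos_right hr hr'
  rw [mem_core_of_mem_boundary hLb, mem_core_of_mem_boundary hRb]
  constructor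
  · intro heq j hj
    by_cases hj0 : j = 0
    · rw [hj0, mem_core_of_mem_boundary hLb]
    by_cases hjN : j = N + 1
    · rw [hjN, mem_core_of_mem_boundary hRb, heq]
    rw [site_mem_core_iff hr hr' (by omega) (by omega), ← heq, and_self]
    constructor
    · rintro (h | ⟨hT, hB⟩)
      · exact h
      · by_contra hL
        have hL' := mem_run_neg_iff.2 ⟨hLb, hL⟩
        have hR' := mem_run_neg_iff.2 ⟨hRb, fun h => hL (heq.2 h)⟩
        have pT := pos_top (N := N) (c := j) (by omega)
        have pB := pos_bottom (N := N) (c := j) (by omega)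
        -- A column with both ends in `R^s` and a row with both ends in `R^{-s}` would cross, and
        -- their four ends would alternate.
        have := run_between hx hB hT hR' hL' (by omega) (by omega)
        omega
    · exact Or.inl
  · intro hne i j hij hj hj'
    by_cases hi0 : i = 0
    · rw [hi0, mem_core_of_mem_boundary hLb]
    by_cases hjN : j = N + 1
    · rw [hjN, mem_core_of_mem_boundary hRb] at hj'
      exact absurd hj'.symm hne
    have hnb : ¬ (site N r 0 ∈ run x s ∧ site N r (N + 1) ∈ run x s) := fun h =>
      hne (iff_of_true h.1 h.2)
    rw [site_mem_core_iff hr hr' (by omega) (by omega), or_iff_right hnb] at hj' ⊢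
    have pTi := pos_top (N := N) (c := i) (by omega)
    have pBi := pos_bottom (N := N) (c := i) (by omega)
    have pTj := pos_top (N := N) (c := j) (by omega)
    have pBj := pos_bottom (N := N) (c := j) (by omega)
    by_cases hL : site N r 0 ∈ run x s
    · have hR : site N r (N + 1) ∈ run x (-s) :=
        mem_run_neg_iff.2 ⟨hRb, fun h => hnb ⟨hL, h⟩⟩
      simp only [hL, iff_true] at hj' ⊢
      constructor
      · by_contra h
        have h' := mem_run_neg_iff.2 ⟨hTb i (by omega), h⟩
        have := run_between hx hj'.1 hL h' hR (by omega) (by omega)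
        omega
      · by_contra h
        have h' := mem_run_neg_iff.2 ⟨hBb i (by omega), h⟩
        have := run_between hx hj'.2 hL hR h' (by omega) (by omega)
        omega
    · have hR : site N r (N + 1) ∈ run x s := by
        by_contra h
        exact hne (iff_of_false hL h)
      have hL' := mem_run_neg_iff.2 ⟨hLb, hL⟩
      simp only [hL, iff_false] at hj' ⊢
      rintro ⟨hT, hB⟩
      refine hj' ⟨?_, ?_⟩
      · by_contra h
        have h' := mem_run_neg_iff.2 ⟨hTb j (by omega), h⟩
        have := run_between hx hR hT h' hL' (by omega) (by omega)
        omega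
      · by_contra h
        have h' := mem_run_neg_iff.2 ⟨hBb j (by omega), h⟩
        have := run_between hx hB hR h' hL' (by omega) (by omega)
        omega

end Core

/-! ### The configuration of a core -/

section CoreConfig

variable {x : BoundaryConfig N} {s : ℤˣ}

theorem glue_of_mem_interior (x : BoundaryConfig N) (y : InteriorConfig N) {v : Site N}
    (h : v ∈ interior N) : glue x y v = y ⟨v, h⟩ := dif_pos h

theorem glue_eq_iff_of_mem_boundary (y : InteriorConfig N) {v : Site N} (h : v ∈ boundary N) :
    glue x y v = s ↔ v ∈ run x s := by
  rw [glue, dif_neg h]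
  exact ⟨fun h' => ⟨h, h'⟩, fun ⟨_, h'⟩ => h'⟩

theorem glue_eq_of_mem_boundary (y y' : InteriorConfig N) {v : Site N} (h : v ∈ boundary N) :
    glue x y v = glue x y' v := by
  rw [glue, dif_neg h, glue, dif_neg h]

open Classical in
/-- The configuration with value `s` in the core of sign `s` and the value `-s` elsewhere. -/
noncomputable def coreConfig (x : BoundaryConfig N) (s : ℤˣ) : InteriorConfig N :=
  fun v => if (v : Site N) ∈ core x s then s else -s

theorem glue_coreConfig_eq_iff (v : Site N) :
    glue x (coreConfig x s) v = s ↔ v ∈ core x s := by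
  by_cases h : v ∈ interior N
  · rw [glue_of_mem_interior x _ h, coreConfig]
    split_ifs with h'
    · exact iff_of_true rfl h'
    · exact iff_of_false (units_ne_neg s).symm h'
  · rw [glue_eq_iff_of_mem_boundary _ h, mem_core_of_mem_boundary h]

theorem glue_coreConfig_eq_glue_iff (v w : Site N) :
    glue x (coreConfig x s) v = glue x (coreConfig x s) w ↔ (v ∈ core x s ↔ w ∈ core x s) := by
  rw [← glue_coreConfig_eq_iff, ← glue_coreConfig_eq_iff]
  constructor
  · intro h
    rw [h]
  · intro h
    rcases units_eq_or s (glue x (coreConfig x s) v) with h₁ | h₁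
    · rw [h₁, h.1 h₁]
    · rcases units_eq_or s (glue x (coreConfig x s) w) with h₂ | h₂
      · rw [h₂, h.2 h₂]
      · rw [h₁, h₂]

theorem isTight_row_coreConfig (hx : IsOneRun x) {r : ℕ} (hr : r ∈ Finset.Icc 1 N) :
    IsTight (values x (coreConfig x s) r) (N + 1) := by
  rw [Finset.mem_Icc] at hr
  obtain ⟨h₁, h₂⟩ := core_row hx s hr.1 hr.2
  refine isTight_of ?_ ?_
  · simp only [values, glue_coreConfig_eq_glue_iff]
    exact h₁
  · simp only [values, ne_eq, glue_coreConfig_eq_glue_iff]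
    exact h₂

/-- The definition of the core is symmetric in rows and columns, so transposition reduces this to
`core_row`. -/
theorem isTight_col_coreConfig (hx : IsOneRun x) {c : ℕ} (hc : c ∈ Finset.Icc 1 N) :
    IsTight (fun i => values x (coreConfig x s) i c) (N + 1) := by
  obtain ⟨x', hx'⟩ := isReflection_transpose.exists_reflects x
  have hc' := hc
  rw [Finset.mem_Icc] at hc
  obtain ⟨h₁, h₂⟩ := core_row (hx'.isOneRun hx) s hc.1 hc.2
  simp only [hx'.mem_core_iff, transpose_site] at h₁ h₂
  refine isTight_of ?_ ?_
  · simp only [values, glue_coreConfig_eq_glue_iff]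
    exact h₁
  · simp only [values, ne_eq, glue_coreConfig_eq_glue_iff]
    exact h₂

theorem isTightFor_coreConfig (hx : IsOneRun x) (s : ℤˣ) (y : InteriorConfig N) :
    IsTightFor N (values x (coreConfig x s)) (values x y) where
  row_tight _ hr := isTight_row_coreConfig hx hr
  col_tight _ hc := isTight_col_coreConfig hx hc
  left r hr := glue_eq_of_mem_boundary _ _
    (site_mem_boundary (by rw [Finset.mem_Icc] at hr; omega) (by omega) (by omega))
  right r hr := glue_eq_of_mem_boundary _ _
    (site_mem_boundary (by rw [Finset.mem_Icc] at hr; omega) (by omega) (by omega))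
  top r hr := glue_eq_of_mem_boundary _ _
    (site_mem_boundary (by omega) (by rw [Finset.mem_Icc] at hr; omega) (by omega))
  bottom r hr := glue_eq_of_mem_boundary _ _
    (site_mem_boundary (by omega) (by rw [Finset.mem_Icc] at hr; omega) (by omega))

/-- This holds for both signs, so the two core configurations are global minimizers with equally
many odd bonds. -/
theorem oddBonds_coreConfig_le (hx : IsOneRun x) (s : ℤˣ) (y : InteriorConfig N) :
    oddBonds x (coreConfig x s) ≤ oddBonds x y := by
  rw [oddBonds_eq_totalChanges, oddBonds_eq_totalChanges]
  exact (isTightFor_coreConfig hx s y).total_le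

theorem values_eq_of_mem_run {y : InteriorConfig N} {i j : ℕ} (h : site N i j ∈ run x s) :
    values x y i j = s :=
  (glue_eq_iff_of_mem_boundary y h.1).2 h

theorem oddBonds_coreConfig_add_two_le (hx : IsOneRun x) {i : interior N}
    (hi : (i : Site N) ∈ core x s) {y : InteriorConfig N} (hy : y i = -s) :
    oddBonds x (coreConfig x s) + 2 ≤ oddBonds x y := by
  have ht := isTightFor_coreConfig hx s y
  have hint := mem_interior_iff.1 i.2
  have hv : values x y (i : Site N).1 (i : Site N).2 ≠ s := by
    rw [values, site_coords, glue_of_mem_interior x y i.2, hy]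
    exact (units_ne_neg s).symm
  rw [oddBonds_eq_totalChanges, oddBonds_eq_totalChanges]
  rcases hi with hi | ⟨-, ⟨h₁, h₂⟩ | ⟨h₁, h₂⟩⟩
  · exact absurd i.2 hi.1
  · exact ht.total_add_two_le (Finset.mem_Icc.2 ⟨hint.1, hint.2.1⟩) (by omega) hv
      (values_eq_of_mem_run h₁) (values_eq_of_mem_run h₂)
  · rw [← totalChanges_swap, ← totalChanges_swap N (values x y)]
    exact ht.swap.total_add_two_le (Finset.mem_Icc.2 hint.2.2) (by omega) hv
      (values_eq_of_mem_run h₁) (values_eq_of_mem_run h₂)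

theorem oddBonds_coreConfig_add_four_le (hx : IsOneRun x) {i : interior N}
    (hi : (i : Site N) ∈ core x s) (hnb : ∀ w, (grid N).Adj i w → w ∈ core x s)
    {y : InteriorConfig N} (hy : y i = -s) :
    oddBonds x (coreConfig x s) + 4 ≤ oddBonds x y := by
  have ht := isTightFor_coreConfig hx s y
  obtain ⟨hint₁, hint₂, hint₃, hint₄⟩ := mem_interior_iff.1 i.2
  have hv : values x y (i : Site N).1 (i : Site N).2 ≠ s := by
    rw [values, site_coords, glue_of_mem_interior x y i.2, hy]
    exact (units_ne_neg s).symm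
  have hcore : ∀ a b, ((a + 1 = ((i : Site N).1 : ℕ) ∨ ((i : Site N).1 : ℕ) + 1 = a) ∧
      b = ((i : Site N).2 : ℕ)) ∨ ((b + 1 = ((i : Site N).2 : ℕ) ∨
        ((i : Site N).2 : ℕ) + 1 = b) ∧ a = ((i : Site N).1 : ℕ)) → site N a b ∈ core x s := by
    intro a b hab
    refine hnb _ ?_
    rw [grid_adj_iff, site_fst (by omega), site_snd (by omega)]
    omega
  have hends : ∀ a b, site N a b ∈ core x s → a ≤ N + 1 → b ≤ N + 1 →
      ((a = 0 ∨ a = N + 1 ∨ b = 0 ∨ b = N + 1) → values x y a b = s) ∧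
      (1 ≤ a ∧ a ≤ N ∧ 1 ≤ b ∧ b ≤ N → (values x y a 0 = s ∧ values x y a (N + 1) = s) ∨
        (values x y 0 b = s ∧ values x y (N + 1) b = s)) := by
    intro a b hab ha hb
    constructor
    · intro h
      exact values_eq_of_mem_run
        ((mem_core_of_mem_boundary (site_mem_boundary ha hb h)).1 hab)
    · rintro ⟨h₁, h₂, h₃, h₄⟩
      exact ((site_mem_core_iff h₁ h₂ h₃ h₄).1 hab).imp
        (fun h => ⟨values_eq_of_mem_run h.1, values_eq_of_mem_run h.2⟩)
        (fun h => ⟨values_eq_of_mem_run h.1, values_eq_of_mem_run h.2⟩)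
  rw [oddBonds_eq_totalChanges, oddBonds_eq_totalChanges]
  rcases hi with hi | ⟨-, ⟨h₁, h₂⟩ | ⟨h₁, h₂⟩⟩
  · exact absurd i.2 hi.1
  · refine ht.total_add_four_le (Finset.mem_Icc.2 ⟨hint₁, hint₂⟩)
      (Finset.mem_Icc.2 ⟨hint₃, hint₄⟩) hv
      (values_eq_of_mem_run h₁) (values_eq_of_mem_run h₂) fun r' hr' => ?_
    obtain ⟨h₃, h₄⟩ := hends r' _ (hcore r' _ (Or.inl ⟨hr', rfl⟩)) (by omega) (by omega)
    exact ⟨fun h => h₃ (by omega), fun h => h₄ (by rw [Finset.mem_Icc] at h; omega)⟩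
  · rw [← totalChanges_swap, ← totalChanges_swap N (values x y)]
    refine ht.swap.total_add_four_le (Finset.mem_Icc.2 ⟨hint₃, hint₄⟩)
      (Finset.mem_Icc.2 ⟨hint₁, hint₂⟩) hv
      (values_eq_of_mem_run h₁) (values_eq_of_mem_run h₂) fun c' hc' => ?_
    obtain ⟨h₃, h₄⟩ := hends _ c' (hcore _ c' (Or.inr ⟨hc', rfl⟩)) (by omega) (by omega)
    exact ⟨fun h => h₃ (by omega), fun h => (h₄ (by rw [Finset.mem_Icc] at h; omega)).symm⟩

/-- A change of the core configuration at a site of the core. -/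
theorem exists_oddBonds_le {i : interior N} (hi : (i : Site N) ∈ core x s) :
    ∃ y : InteriorConfig N, y i = -s ∧ oddBonds x y ≤ oddBonds x (coreConfig x s) + 4 ∧
      ((∃ w, (grid N).Adj i w ∧ w ∉ core x s) →
        oddBonds x y ≤ oddBonds x (coreConfig x s) + 2) := by
  classical
  obtain ⟨hint₁, hint₂, hint₃, hint₄⟩ := mem_interior_iff.1 i.2
  let y := Function.update (coreConfig x s) i (-s)
  have hyi : y i = -s := Function.update_self ..
  have hy : ∀ v : Site N, v ≠ i → glue x y v = glue x (coreConfig x s) v := by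
    intro v hv
    by_cases h : v ∈ interior N
    · rw [glue_of_mem_interior x _ h, glue_of_mem_interior x _ h]
      exact Function.update_of_ne (fun h' => hv (congrArg Subtype.val h')) _ _
    · exact glue_eq_of_mem_boundary _ _ h
  -- Indices of `site` are reduced modulo `N + 2`, so in `values` one flipped site would recur at
  -- infinitely many places. The arrays are therefore set to 1 outside the grid, which does not
  -- affect `totalChanges`.
  obtain ⟨h₁, h₂⟩ := totalChanges_flip_le (X := fun a b => if a ≤ N + 1 ∧ b ≤ N + 1 then
      values x (coreConfig x s) a b else 1) (X' := fun a b => if a ≤ N + 1 ∧ b ≤ N + 1 then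
      values x y a b else 1)
    (Finset.mem_Icc.2 ⟨hint₁, hint₂⟩) (Finset.mem_Icc.2 ⟨hint₃, hint₄⟩) (by
      intro a b hab
      split_ifs with h
      · refine hy _ fun he => hab ?_
        rw [← he, site_fst h.1, site_snd h.2]
        exact ⟨rfl, rfl⟩
      · rfl)
  have htot : ∀ z : InteriorConfig N, totalChanges N (fun a b => if a ≤ N + 1 ∧ b ≤ N + 1 then
      values x z a b else 1) = oddBonds x z := by
    intro z
    rw [oddBonds_eq_totalChanges, totalChanges, totalChanges]
    congr 1 <;> refine Finset.sum_congr rfl fun a ha => ?_ <;> rw [Finset.mem_Icc] at ha <;>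
      exact signChanges_congr fun j _ hj => if_pos (by omega)
  rw [htot, htot] at h₁ h₂
  refine ⟨y, hyi, h₁, ?_⟩
  rintro ⟨w, hw, hwc⟩
  have hne : glue x (coreConfig x s) w ≠ glue x (coreConfig x s) i := by
    rw [Ne, glue_coreConfig_eq_glue_iff]
    exact fun h => hwc (h.2 hi)
  rw [grid_adj_iff] at hw
  have hw₁ := w.fst_le
  have hw₂ := w.snd_le
  refine h₂ ?_ ?_
  · rw [if_pos (by omega), if_pos (by omega), values, values, site_coords,
      glue_of_mem_interior x y i.2, hyi, (glue_coreConfig_eq_iff (i : Site N)).2 hi]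
    exact (units_ne_neg s).symm
  · rw [if_pos (by omega), if_pos (by omega), if_pos (by omega), if_pos (by omega),
      if_pos (by omega)]
    simp only [values, site_coords]
    rcases hw with ⟨h | h, h'⟩ | ⟨h | h, h'⟩
    · rw [eq_site h.symm h'.symm] at hne
      exact Or.inr (Or.inr (Or.inr hne))
    · rw [eq_site (v := w) (i := (i : Site N).1 - 1) (by omega) h'.symm] at hne
      exact Or.inr (Or.inr (Or.inl hne))
    · rw [eq_site h'.symm h.symm] at hne
      exact Or.inr (Or.inl hne)
    · rw [eq_site (v := w) (j := (i : Site N).2 - 1) h'.symm (by omega)] at hne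
      exact Or.inl hne

end CoreConfig

/-! ### Local solutions -/

section LocalSolution

variable {x : BoundaryConfig N} {s : ℤˣ} {i : interior N}

theorem minOddBonds_eq {t : ℤˣ} {m : ℕ} (hm : ∀ y : InteriorConfig N, y i = t → m ≤ oddBonds x y)
    (h : ∃ y : InteriorConfig N, y i = t ∧ oddBonds x y ≤ m) : minOddBonds x i t = m := by
  obtain ⟨y, hy, hle⟩ := h
  have hmem : oddBonds x y ∈ oddBonds x '' {y : InteriorConfig N | y i = t} := ⟨y, hy, rfl⟩
  refine le_antisymm ((Nat.sInf_le hmem).trans hle) (le_csInf ⟨_, hmem⟩ ?_)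
  rintro _ ⟨z, hz, rfl⟩
  exact hm z hz

theorem minOddBonds_of_mem_core (hx : IsOneRun x) (hi : (i : Site N) ∈ core x s) :
    minOddBonds x i s = oddBonds x (coreConfig x s) :=
  minOddBonds_eq (fun y _ => oddBonds_coreConfig_le hx s y)
    ⟨coreConfig x s, if_pos hi, le_rfl⟩

/-- Outside its core, the minimizer of sign `s` has the value `-s`. -/
theorem minOddBonds_of_notMem_core (hx : IsOneRun x) (hi : (i : Site N) ∉ core x s) :
    minOddBonds x i (-s) = oddBonds x (coreConfig x s) :=
  minOddBonds_eq (fun y _ => oddBonds_coreConfig_le hx s y)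
    ⟨coreConfig x s, if_neg hi, le_rfl⟩

theorem minOddBonds_neg_of_rim (hx : IsOneRun x) (hi : (i : Site N) ∈ core x s)
    (hnb : ∃ w, (grid N).Adj i w ∧ w ∉ core x s) :
    minOddBonds x i (-s) = oddBonds x (coreConfig x s) + 2 := by
  obtain ⟨y, hy, -, h⟩ := exists_oddBonds_le hi
  exact minOddBonds_eq (fun z hz => oddBonds_coreConfig_add_two_le hx hi hz) ⟨y, hy, h hnb⟩

theorem minOddBonds_neg_of_not_rim (hx : IsOneRun x) (hi : (i : Site N) ∈ core x s)
    (hnb : ∀ w, (grid N).Adj i w → w ∈ core x s) :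
    minOddBonds x i (-s) = oddBonds x (coreConfig x s) + 4 := by
  obtain ⟨y, hy, h, -⟩ := exists_oddBonds_le hi
  exact minOddBonds_eq (fun z hz => oddBonds_coreConfig_add_four_le hx hi hnb hz) ⟨y, hy, h⟩

end LocalSolution

end GridInterp

/-! ### The local solutions in terms of the inner and outer regions. -/

theorem proposition1 (N : ℕ) (x : GridInterp.BoundaryConfig N) (hx : GridInterp.IsOneRun x) :
    (∀ s : ℤˣ, (∃! P, GridInterp.IsInnerPath x s P) ∧ (∃! P, GridInterp.IsOuterPath x s P)) ∧
    (∀ i : GridInterp.interior N,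
      ((i : GridInterp.Site N) ∈ GridInterp.innerRegion x 1 \ GridInterp.innerRim x 1 →
        GridInterp.localSolution x i = 4) ∧
      ((i : GridInterp.Site N) ∈ GridInterp.innerRegion x (-1) \ GridInterp.innerRim x (-1) →
        GridInterp.localSolution x i = -4) ∧
      ((i : GridInterp.Site N) ∈ GridInterp.innerRim x 1 →
        GridInterp.localSolution x i = 2) ∧
      ((i : GridInterp.Site N) ∈ GridInterp.innerRim x (-1) →
        GridInterp.localSolution x i = -2) ∧
      ((i : GridInterp.Site N) ∈ GridInterp.outerRegion x 1 ∩ GridInterp.outerRegion x (-1) →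
        GridInterp.localSolution x i = 0) ∧
      (i : GridInterp.Site N) ∈ GridInterp.innerRegion x 1 ∪ GridInterp.innerRegion x (-1) ∪
        (GridInterp.outerRegion x 1 ∩ GridInterp.outerRegion x (-1))) := by
  have hpaths := GridInterp.pathsBoundCores_of_isOneRun hx
  refine ⟨fun s => ⟨(hpaths s).1, (hpaths s).2.1⟩, fun i => ?_⟩
  have hin : ∀ s : ℤˣ, (i : GridInterp.Site N) ∈ GridInterp.innerRegion x s ↔
      (i : GridInterp.Site N) ∈ GridInterp.core x s := fun s => by
    rw [GridInterp.innerRegion, (hpaths s).2.2.1]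
    exact and_iff_left i.2
  have hout : ∀ s : ℤˣ, (i : GridInterp.Site N) ∈ GridInterp.outerRegion x s ↔
      (i : GridInterp.Site N) ∉ GridInterp.core x (-s) := fun s => by
    rw [GridInterp.outerRegion, (hpaths s).2.2.2]
    exact and_iff_left i.2
  -- Since `O^{-s}` is the complement of the core of sign `s`, touching it means having a neighbour
  -- outside that core, the condition that separates cost 2 from cost 4.
  have hrim : ∀ s : ℤˣ, (i : GridInterp.Site N) ∈ GridInterp.innerRim x s ↔
      (i : GridInterp.Site N) ∈ GridInterp.core x s ∧
        ∃ w, (GridInterp.grid N).Adj i w ∧ w ∉ GridInterp.core x s := fun s => by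
    rw [← hin s]
    simp only [GridInterp.innerRim, (hpaths (-s)).2.2.2, neg_neg, Set.mem_ofPred_eq,
      Set.mem_compl_iff]
    exact and_congr_right fun _ => exists_congr fun _ => and_comm
  have hdeep : ∀ s : ℤˣ,
      (i : GridInterp.Site N) ∈ GridInterp.innerRegion x s \ GridInterp.innerRim x s →
      (GridInterp.minOddBonds x i (-s) : ℤ) - GridInterp.minOddBonds x i s = 4 := by
    rintro s ⟨h₁, h₂⟩
    rw [hin] at h₁
    rw [hrim] at h₂
    rw [GridInterp.minOddBonds_of_mem_core hx h₁, GridInterp.minOddBonds_neg_of_not_rim hx h₁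
      fun w hw => by_contra fun hwc => h₂ ⟨h₁, w, hw, hwc⟩]
    push_cast
    ring
  have hshallow : ∀ s : ℤˣ, (i : GridInterp.Site N) ∈ GridInterp.innerRim x s →
      (GridInterp.minOddBonds x i (-s) : ℤ) - GridInterp.minOddBonds x i s = 2 := by
    intro s h
    rw [hrim] at h
    rw [GridInterp.minOddBonds_of_mem_core hx h.1, GridInterp.minOddBonds_neg_of_rim hx h.1 h.2]
    push_cast
    ring
  refine ⟨hdeep 1, fun h => ?_, hshallow 1, fun h => ?_, fun h => ?_, ?_⟩
  · have := hdeep (-1) h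
    rw [neg_neg] at this
    rw [GridInterp.localSolution]
    omega
  · have := hshallow (-1) h
    rw [neg_neg] at this
    rw [GridInterp.localSolution]
    omega
  -- Here `i` is in neither core: the minimum with value `-1` is attained by the core configuration
  -- of sign `1`, the minimum with value `1` by that of sign `-1`, and both equal the global
  -- minimum.
  · obtain ⟨h₁, h₂⟩ := h
    rw [hout] at h₁ h₂
    rw [neg_neg] at h₂
    have h₃ := GridInterp.minOddBonds_of_notMem_core hx h₁
    rw [neg_neg] at h₃
    rw [GridInterp.localSolution, GridInterp.minOddBonds_of_notMem_core hx h₂, h₃, sub_eq_zero,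
      Nat.cast_inj]
    exact le_antisymm (GridInterp.oddBonds_coreConfig_le hx _ _)
      (GridInterp.oddBonds_coreConfig_le hx _ _)
  · rw [Set.mem_union, Set.mem_union, Set.mem_inter_iff, hin, hin, hout, hout, neg_neg]
    tauto
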